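/- **Setting.** An instance of the unweighted two-stage facility location game with atomic clients consists of a directed host graph $H=(V,E)$ whose $n$ vertices are the clients, each of weight $w(v)=1$, a set $F$ of $k$ facilities, and a set $U(f)\subseteq V$ of feasible locations for each $f\in F$. A facility placement profile (FPP) is a vector $\mathbf s=(s_f)_{f\in F}$ with $s_f\in U(f)$. Put $N(v)=\{v\}\cup\{u : (v,u)\in E\}$, $N_{\mathbf s}(v)=\{f\in F: s_f\in N(v)\}$ and, for $X\subseteq F$, $A_{\mathbf s}(X)=\{v\in V: N_{\mathbf s}(v)\cap X\neq\varnothing\}$. A client profile for $\mathbf s$ is a function $\sigma:V\to[0,1]^F$ with $\sigma_{v,f}=0$ for $f\notin N_{\mathbf s}(v)$ and $\sum_{f\in N_{\mathbf s}(v)}\sigma_{v,f}=1$ whenever $N_{\mathbf s}(v)\ne\varnothing$. The load of $f$ is $\ell_f(\sigma)=\sum_{v}\sigma_{v,f}w(v)$. Client $v$ has expected waiting time $L_v(\sigma)=w(v)+\sum_{f\in N_{\mathbf s}(v)}\sigma_{v,f}\sum_{u\ne v}\sigma_{u,f}w(u)$, and $\sigma$ is a client equilibrium if no client can decrease her expected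 waiting time by unilaterally changing her strategy to another feasible one. *Classes.* For $F^*\subseteq F$, $V^*\subseteq V$ let $\mathrm{MNS}_{\mathbf s}(F^*,V^*)$ be the largest set among the nonempty $T\subseteq F^*$ that minimize $w(A_{\mathbf s}(T)\cap V^*)/|T|$. For $i\ge 1$, as long as unclassified facilities remain, define the class $C_i=(F_i,V_i)$ by $F_i=\mathrm{MNS}_{\mathbf s}\bigl(F\setminus\bigcup_{j<i}F_j,\ V\setminus\bigcup_{j<i}V_j\bigr)$ and $V_i=A_{\mathbf s}(F_i)\setminus\bigcup_{j<i}V_j$, with average load $\ell(C_i)=w(V_i)/|F_i|$. A client profile $\sigma$ is *rounded* if for every $i$ we have $\ell_f(\sigma)\in\{\lfloor\ell(C_i)\rfloor,\lceil\ell(C_i)\rceil\}$ for all $f\in F_i$, and for every $v\in V_i$ there is exactly one $g\in F_i$ with $\sigma_{v,g}=1$. For a permutation $\pi$ of $F=\{1,\dots,k\}$, a client equilibrium $\sigma$ is a *$\pi$-favoring* rounded client equilibrium if it is rounded and the vector $(\ell_{\pi(1)}(\sigma),\dots,\ell_{\pi(k)}(\sigma))$ is lexicographically maximal among all rounded client profiles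 for $\mathbf s$. **Theorem ($\pi$-favoring Equilibria Complexity).** There is a polynomial-time algorithm that, given the host graph $H$ of such an instance (as an adjacency matrix), an FPP $\mathbf s$ and a permutation $\pi$ of the facilities, computes a $\pi$-favoring rounded client equilibrium for $\mathbf s$, given as the list that names for each client the facility she patronizes, if any. Precisely: there are a single program for a random access machine, whose elementary operations (constants, reading and writing variables and array cells, addition, truncated subtraction, tests for zero) cost one step each, and a polynomial $p$, such that on every input as above the program halts with a correct output after at most $p(N)$ steps, where $N=2+n^2+2k$ is the number of entries of the input. -/

import Mathlib

open scoped BigOperators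

/-! ## A random access machine with a step count -/

namespace RAM

/-- Expressions over natural-number variables `x₀, x₁, …` and arrays `M₀, M₁, …`. The only arithmetic
operations are addition and truncated subtraction. -/
inductive Expr : Type
  | const (c : ℕ) : Expr
  | var (x : ℕ) : Expr
  | read (a : ℕ) (i : Expr) : Expr
  | add (e₁ e₂ : Expr) : Expr
  | sub (e₁ e₂ : Expr) : Expr

/-- Programs. A program is a finite object, so it mentions finitely many variables and arrays.
`assign x e` is `x := e`; `write a i e` is `Mₐ[i] := e`; `ite e P Q` runs `P` if `e ≠ 0` and `Q`
otherwise; `loop e P` repeats `P` while `e ≠ 0`. -/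
inductive Prog : Type
  | skip : Prog
  | assign (x : ℕ) (e : Expr) : Prog
  | write (a : ℕ) (i e : Expr) : Prog
  | seq (P Q : Prog) : Prog
  | ite (e : Expr) (P Q : Prog) : Prog
  | loop (e : Expr) (P : Prog) : Prog

/-- A memory state: the contents of the variables and of the arrays. -/
structure State where
  var : ℕ → ℕ
  arr : ℕ → ℕ → ℕ

/-- The value of an expression. -/
def Expr.eval (m : State) : Expr → ℕ
  | .const c => c
  | .var x => m.var x
  | .read a i => m.arr a (i.eval m)
  | .add e₁ e₂ => e₁.eval m + e₂.eval m
  | .sub e₁ e₂ => e₁.eval m - e₂.eval m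

/-- The number of elementary operations in the evaluation of an expression. -/
def Expr.cost : Expr → ℕ
  | .const _ => 1
  | .var _ => 1
  | .read _ i => i.cost + 1
  | .add e₁ e₂ => e₁.cost + e₂.cost + 1
  | .sub e₁ e₂ => e₁.cost + e₂.cost + 1

/-- `m.setVar x c` is the state `m` after the assignment `x := c`. -/
def State.setVar (m : State) (x c : ℕ) : State :=
  { m with var := Function.update m.var x c }

/-- `m.setArr a i c` is the state `m` after the assignment `Mₐ[i] := c`. -/
def State.setArr (m : State) (a i c : ℕ) : State :=
  { m with arr := Function.update m.arr a (Function.update (m.arr a) i c) }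

/-- `Runs P m t m'`: started in state `m`, the program `P` terminates in state `m'` after exactly `t`
elementary steps. Every assignment, test and elementary operation is one step. As there is
no multiplication, numbers grow by at most one bit per step, so that this step count is polynomially
related to Turing machine time. -/
inductive Runs : Prog → State → ℕ → State → Prop
  | skip (m : State) : Runs .skip m 1 m
  | assign (x : ℕ) (e : Expr) (m : State) :
      Runs (.assign x e) m (e.cost + 1) (m.setVar x (e.eval m))
  | write (a : ℕ) (i e : Expr) (m : State) :
      Runs (.write a i e) m (i.cost + e.cost + 1) (m.setArr a (i.eval m) (e.eval m))
  | seq {P Q : Prog} {m m₁ m₂ : State} {t₁ t₂ : ℕ} :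
      Runs P m t₁ m₁ → Runs Q m₁ t₂ m₂ → Runs (.seq P Q) m (t₁ + t₂) m₂
  | ite_true {e : Expr} {P Q : Prog} {m m₁ : State} {t : ℕ} :
      e.eval m ≠ 0 → Runs P m t m₁ → Runs (.ite e P Q) m (e.cost + 1 + t) m₁
  | ite_false {e : Expr} {P Q : Prog} {m m₁ : State} {t : ℕ} :
      e.eval m = 0 → Runs Q m t m₁ → Runs (.ite e P Q) m (e.cost + 1 + t) m₁
  | loop_true {e : Expr} {P : Prog} {m m₁ m₂ : State} {t₁ t₂ : ℕ} :
      e.eval m ≠ 0 → Runs P m t₁ m₁ → Runs (.loop e P) m₁ t₂ m₂ →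
        Runs (.loop e P) m (e.cost + 1 + t₁ + t₂) m₂
  | loop_false {e : Expr} {P : Prog} {m : State} :
      e.eval m = 0 → Runs (.loop e P) m (e.cost + 1) m

/-- The machine is deterministic: the final state and the step count are determined by the
program and the initial state. -/
theorem Runs.deterministic {P : Prog} {m m₁ m₂ : State} {t₁ t₂ : ℕ}
    (h₁ : Runs P m t₁ m₁) (h₂ : Runs P m t₂ m₂) : t₁ = t₂ ∧ m₁ = m₂ := by
  induction h₁ generalizing t₂ m₂ with
  | skip | assign | write => cases h₂; exact ⟨rfl, rfl⟩
  | seq _ _ ih ih' =>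
    cases h₂ with
    | seq h h' =>
      obtain ⟨rfl, rfl⟩ := ih h
      obtain ⟨rfl, rfl⟩ := ih' h'
      exact ⟨rfl, rfl⟩
  | ite_true he _ ih | ite_false he _ ih =>
    cases h₂ with
    | ite_true he' h => first | exact absurd he he' | (obtain ⟨rfl, rfl⟩ := ih h; exact ⟨rfl, rfl⟩)
    | ite_false he' h => first | exact absurd he' he | (obtain ⟨rfl, rfl⟩ := ih h; exact ⟨rfl, rfl⟩)
  | loop_true he _ _ ih ih' =>
    cases h₂ with
    | loop_true _ h h' =>
      obtain ⟨rfl, rfl⟩ := ih h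
      obtain ⟨rfl, rfl⟩ := ih' h'
      exact ⟨rfl, rfl⟩
    | loop_false he' => exact absurd he' he
  | loop_false he =>
    cases h₂ with
    | loop_true he' _ _ => exact absurd he he'
    | loop_false => exact ⟨rfl, rfl⟩

/-- The initial state: the input is in array `0` and its length in variable `0`; all else is `0`. -/
def State.init (input : List ℕ) : State where
  var x := if x = 0 then input.length else 0
  arr a i := if a = 0 then input.getD i 0 else 0

/-- The output of a final state: the first `x₀` entries of array `0`. -/
def State.output (m : State) : List ℕ :=
  (List.range (m.var 0)).map (m.arr 0)

/-- On the given input, `P` terminates after exactly `t` steps with the given output. -/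
def Prog.Outputs (P : Prog) (input output : List ℕ) (t : ℕ) : Prop :=
  ∃ m : State, Runs P (State.init input) t m ∧ m.output = output

end RAM

/-! ## The two-stage facility location game with atomic clients -/

/-- An instance with client set `V = Fin n` and facility set `F = Fin k`: a vertex-weighted directed
host graph with positive rational weights, and the feasible locations of each facility. -/
structure FLG (n k : ℕ) where
  host : Digraph (Fin n)
  w : Fin n → ℚ
  w_pos : ∀ v, 0 < w v
  U : Fin k → Set (Fin n)

/-- A client profile for a fixed facility placement profile: `σ v f` is the probability that client
`v` patronizes facility `f`. -/
abbrev ClientProfile (n k : ℕ) : Type := Fin n → Fin k → ℝ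

namespace FLG

variable {n k : ℕ}

/-- All clients have weight `1`. -/
def Unweighted (I : FLG n k) : Prop := ∀ v, I.w v = 1

/-- Facility placement profiles. -/
def IsFPP (I : FLG n k) (s : Fin k → Fin n) : Prop := ∀ f, s f ∈ I.U f

/-- The closed out-neighborhood `N(v)`. -/
def nbhd (I : FLG n k) (v : Fin n) : Set (Fin n) := {v} ∪ {u | I.host.Adj v u}

open Classical in
/-- The shopping range `N_s(v)` of a client. -/
noncomputable def range (I : FLG n k) (s : Fin k → Fin n) (v : Fin n) : Finset (Fin k) :=
  Finset.univ.filter fun f => s f ∈ I.nbhd v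

/-- The attraction range `A_s(X)` of a set of facilities. -/
noncomputable def attraction (I : FLG n k) (s : Fin k → Fin n) (X : Finset (Fin k)) :
    Finset (Fin n) :=
  Finset.univ.filter fun v => ∃ f ∈ X, f ∈ I.range s v

/-- The total weight of a set of clients. -/
def weight (I : FLG n k) (X : Finset (Fin n)) : ℚ := ∑ v ∈ X, I.w v

/-- Feasible (mixed) strategies of client `v`. -/
def FeasibleStrategy (I : FLG n k) (s : Fin k → Fin n) (v : Fin n) (τ : Fin k → ℝ) : Prop :=
  (∀ f, 0 ≤ τ f ∧ τ f ≤ 1) ∧ (∀ f, f ∉ I.range s v → τ f = 0) ∧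
    ((I.range s v).Nonempty → ∑ f ∈ I.range s v, τ f = 1)

/-- Feasible client profiles. -/
def Feasible (I : FLG n k) (s : Fin k → Fin n) (σ : ClientProfile n k) : Prop :=
  ∀ v, I.FeasibleStrategy s v (σ v)

/-- The expected load of facility `f`. -/
noncomputable def load (I : FLG n k) (σ : ClientProfile n k) (f : Fin k) : ℝ :=
  ∑ v, σ v f * (I.w v : ℝ)

/-- The `v`-excluded load of facility `f`. -/
noncomputable def loadExcl (I : FLG n k) (σ : ClientProfile n k) (v : Fin n) (f : Fin k) : ℝ :=
  ∑ u ∈ Finset.univ.erase v, σ u f * (I.w u : ℝ)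

/-- The expected waiting time of client `v`. -/
noncomputable def waitingTime (I : FLG n k) (s : Fin k → Fin n) (σ : ClientProfile n k)
    (v : Fin n) : ℝ :=
  (I.w v : ℝ) + ∑ f ∈ I.range s v, σ v f * I.loadExcl σ v f

/-- Client equilibria: feasible client profiles in which no client can lower her expected waiting time
by switching to another feasible strategy. -/
def IsClientEquilibrium (I : FLG n k) (s : Fin k → Fin n) (σ : ClientProfile n k) : Prop :=
  I.Feasible s σ ∧ ∀ (v : Fin n) (τ : Fin k → ℝ), I.FeasibleStrategy s v τ →
    ¬ I.waitingTime s (Function.update σ v τ) v < I.waitingTime s σ v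

/-- The ratio `w(A_s(T) ∩ V*) / |T|`. -/
noncomputable def ratio (I : FLG n k) (s : Fin k → Fin n) (Vs : Finset (Fin n))
    (T : Finset (Fin k)) : ℚ :=
  I.weight (I.attraction s T ∩ Vs) / (T.card : ℚ)

/-- `T` minimizes the ratio among the nonempty subsets of `F*`. -/
def IsMinRatio (I : FLG n k) (s : Fin k → Fin n) (Fs : Finset (Fin k)) (Vs : Finset (Fin n))
    (T : Finset (Fin k)) : Prop :=
  (T ⊆ Fs ∧ T.Nonempty) ∧
    ∀ T' : Finset (Fin k), T' ⊆ Fs → T'.Nonempty → I.ratio s Vs T ≤ I.ratio s Vs T'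

/-- `T` is a largest set of facilities among those that minimize the ratio. -/
def IsMNS (I : FLG n k) (s : Fin k → Fin n) (Fs : Finset (Fin k)) (Vs : Finset (Fin n))
    (T : Finset (Fin k)) : Prop :=
  I.IsMinRatio s Fs Vs T ∧ ∀ T' : Finset (Fin k), I.IsMinRatio s Fs Vs T' → T'.card ≤ T.card

open Classical in
/-- The minimum neighborhood set `MNS_s(F*, V*)`; it is empty if `F*` is empty. -/
noncomputable def mns (I : FLG n k) (s : Fin k → Fin n) (Fs : Finset (Fin k))
    (Vs : Finset (Fin n)) : Finset (Fin k) :=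
  if h : ∃ T, I.IsMNS s Fs Vs T then h.choose else ∅

/-- The facilities and the clients that belong to the first `i` classes. -/
noncomputable def classified (I : FLG n k) (s : Fin k → Fin n) :
    ℕ → Finset (Fin k) × Finset (Fin n)
  | 0 => (∅, ∅)
  | i + 1 =>
    let D := classified I s i
    let Fi := I.mns s (Finset.univ \ D.1) (Finset.univ \ D.2)
    (D.1 ∪ Fi, D.2 ∪ (I.attraction s Fi \ D.2))

/-- The facilities of the `i`-th class (indices start at `0`, and once all facilities are
classified, the remaining classes are empty). -/
noncomputable def classF (I : FLG n k) (s : Fin k → Fin n) (i : ℕ) : Finset (Fin k) :=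
  I.mns s (Finset.univ \ (I.classified s i).1) (Finset.univ \ (I.classified s i).2)

/-- The clients of the `i`-th class. -/
noncomputable def classV (I : FLG n k) (s : Fin k → Fin n) (i : ℕ) : Finset (Fin n) :=
  I.attraction s (I.classF s i) \ (I.classified s i).2

/-- The average load of the `i`-th class. -/
noncomputable def classLoad (I : FLG n k) (s : Fin k → Fin n) (i : ℕ) : ℚ :=
  I.weight (I.classV s i) / ((I.classF s i).card : ℚ)

/-- Rounded client profiles. -/
def IsRounded (I : FLG n k) (s : Fin k → Fin n) (σ : ClientProfile n k) : Prop :=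
  I.Feasible s σ ∧
    (∀ i, ∀ f ∈ I.classF s i,
      I.load σ f = (⌊I.classLoad s i⌋ : ℝ) ∨ I.load σ f = (⌈I.classLoad s i⌉ : ℝ)) ∧
    ∀ i, ∀ v ∈ I.classV s i, ∃! g, g ∈ I.classF s i ∧ σ v g = 1

/-- The vector `(ℓ_{π(1)}, …, ℓ_{π(k)})` of facility loads, ordered lexicographically. -/
noncomputable def loadVector (I : FLG n k) (π : Equiv.Perm (Fin k)) (σ : ClientProfile n k) :
    Lex (Fin k → ℝ) :=
  toLex fun i => I.load σ (π i)

/-- `π`-favoring client equilibria. -/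
def IsFavoring (I : FLG n k) (s : Fin k → Fin n) (π : Equiv.Perm (Fin k))
    (σ : ClientProfile n k) : Prop :=
  I.IsClientEquilibrium s σ ∧ I.IsRounded s σ ∧
    ∀ σ' : ClientProfile n k, I.IsRounded s σ' → I.loadVector π σ' ≤ I.loadVector π σ

end FLG

/-! ## Encoding of inputs and outputs -/

open Classical in
/-- The input as a list of numbers: `n`, `k`, the adjacency matrix of the host graph row by row, the
locations of the facilities, and the permutation. -/
noncomputable def encodeInput {n k : ℕ} (H : Digraph (Fin n)) (s : Fin k → Fin n)
    (π : Equiv.Perm (Fin k)) : List ℕ :=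
  [n, k] ++ ((List.finRange n).flatMap fun u => (List.finRange n).map fun v =>
      if H.Adj u v then 1 else 0) ++
    (List.finRange k).map (fun f => (s f : ℕ)) ++ (List.finRange k).map (fun i => (π i : ℕ))

/-- The client profile in which client `v` patronizes facility `f` with certainty if
`a v = some f`, and no facility if `a v = none`. -/
def assignmentProfile {n k : ℕ} (a : Fin n → Option (Fin k)) : ClientProfile n k :=
  fun v f => if a v = some f then 1 else 0

/-- An assignment as a list of `n` numbers: `0` for no facility, and `f + 1` for facility `f`. -/
def encodeAssignment {n k : ℕ} (a : Fin n → Option (Fin k)) : List ℕ :=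
  List.ofFn fun v => (a v).elim 0 fun f => (f : ℕ) + 1

/-!
A client profile that is rounded assigns the clients of each class `C_i` to the facilities of `C_i`
with loads that are the class load rounded up or down. Such profiles are found by searching for
*stable* assignments (`IsStable`): `f` passes to `g` if some client of `f` may patronize `g`, and
moving one client at each step of a chain of passes from `f` to `g` lowers the load of `f` and raises
that of `g` by one. An assignment is stable if no such chain improves the pairs (load, position in
`π`), compared lexicographically; the pair is encoded as the number `k * load + position`.

In a stable assignment, the facilities from which `f` can be reached serve all the clients that they
attract, and those that can be reached from `f` serve no client whom any other facility attracts.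
Counting clients against the minimum ratio that defines a class puts all loads of the class strictly
between the class load minus one and plus one (`IsStable.lt_loadOf`, `IsStable.loadOf_lt`). This is
used twice.

* With `4 * k ^ 2` copies of each client, the gaps between class loads exceed the rounding errors,
  since different class loads differ by at least `1 / k ^ 2`. So the loads show which edges stay
  within a class (`FLG.Unweighted.classEdge_iff`), without computing any minimum neighborhood set.
* With the original clients, restricted to the edges within classes, a stable assignment is rounded,
  hence a client equilibrium because class loads increase. If another rounded profile were
  lexicographically larger, then the first facility `f` that it favors would be reached from one that
  comes later in `π` and has load one above that of `f`: an improving chain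
  (`FLG.Unweighted.isFavoring`).

The program keeps an arbitrary assignment along the edges and applies improving chains, found by
exploring the facilities backwards from each possible target `g`, until there are none. The sum of
the squares of the numbers `k * load + position` decreases with each chain, which bounds the number of
chains by a polynomial (`Search.search_spec`). Correctness and step counts are derived with a total
correctness calculus (`RAM.Within`), in which the variables and arrays that a program does not
mention on the left of an assignment are preserved for free (`RAM.Runs.agree`).
-/

/-! ### Stable assignments -/

section Stable

open Relation

variable {Ω F : Type*} [Fintype Ω] [DecidableEq F]

/-- Facility `f` can pass one of its clients on to `g`: some client assigned to `f` may patronize `g`. -/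
def Passes (E : Ω → F → Prop) (a : Ω → Option F) (f g : F) : Prop :=
  ∃ ω, a ω = some f ∧ E ω g

/-- The number of clients assigned to `f`. -/
def loadOf (a : Ω → Option F) (f : F) : ℕ :=
  (Finset.univ.filter fun ω => a ω = some f).card

/-- A (partial) assignment of clients to facilities along the edges of `E` that serves every client
with an edge, and that no chain of passes from `f` to `g` improves. The number
`K * loadOf a f + pos f` with `pos < K` encodes the pair `(load, position)` ordered lexicographically;
a chain of passes is an improvement if this number at `f` beats the one that `g` has afterwards. -/
structure IsStable (E : Ω → F → Prop) (pos : F → ℕ) (K : ℕ) (a : Ω → Option F) : Prop where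
  edge : ∀ ω f, a ω = some f → E ω f
  served : ∀ ω f, E ω f → ∃ g, a ω = some g
  stable : ∀ f g, ReflTransGen (Passes E a) f g →
    K * loadOf a f + pos f ≤ K * loadOf a g + K + pos g

theorem sum_loadOf (a : Ω → Option F) (T : Finset F) :
    ∑ f ∈ T, loadOf a f = (Finset.univ.filter fun ω => ∃ f ∈ T, a ω = some f).card := by
  classical
  unfold loadOf
  rw [← Finset.card_biUnion]
  · congr 1
    ext ω
    simp
  · intro f _ g _ hfg
    rw [Function.onFun, Finset.disjoint_left]
    intro ω h1 h2
    simp only [Finset.mem_filter, Finset.mem_univ, true_and] at h1 h2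
    exact hfg (Option.some.inj (h1.symm.trans h2))

variable {E : Ω → F → Prop} {pos : F → ℕ} {K : ℕ} {a : Ω → Option F}

/-- The facilities from which `g` can be reached contain, with each facility that a client may
patronize, the one to which this client is assigned. -/
theorem IsStable.exists_reach (h : IsStable E pos K a) {ω : Ω} {f g : F} (hE : E ω f)
    (hr : ReflTransGen (Passes E a) f g) :
    ∃ f', a ω = some f' ∧ ReflTransGen (Passes E a) f' g := by
  obtain ⟨f', hf'⟩ := h.served ω f hE
  exact ⟨f', hf', ReflTransGen.head ⟨ω, hf', hE⟩ hr⟩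

theorem IsStable.loadOf_le (h : IsStable E pos K a) (hpos : ∀ f, pos f < K) {f g : F}
    (hr : ReflTransGen (Passes E a) f g) : loadOf a f ≤ loadOf a g + 1 := by
  have h1 := h.stable f g hr
  have h2 := hpos g
  by_contra! hlt
  have : K * (loadOf a g + 2) ≤ K * loadOf a f := Nat.mul_le_mul_left K hlt
  have h3 : K * (loadOf a g + 2) = K * loadOf a g + K + K := by ring
  omega

/-- If every `T ⊆ S` attracts at least `lam * |T|` clients of `W`, and the clients of `W` that `S`
attracts are assigned within `S`, then all loads in `S` exceed `lam - 1`: the facilities from which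
`f` can be reached serve all the clients that they attract. -/
theorem IsStable.lt_loadOf (h : IsStable E pos K a) (hpos : ∀ f, pos f < K)
    (S : Finset F) (W : Finset Ω) (lam : ℚ)
    (hclosed : ∀ ω ∈ W, ∀ f ∈ S, E ω f → ∃ g ∈ S, a ω = some g)
    (hall : ∀ T ⊆ S, T.Nonempty → ∀ X : Finset Ω, (∀ ω ∈ W, ∀ f ∈ T, E ω f → ω ∈ X) →
      lam * T.card ≤ X.card)
    {f : F} (hf : f ∈ S) : lam - 1 < loadOf a f := by
  classical
  set T := S.filter fun g => ReflTransGen (Passes E a) g f with hT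
  have hfT : f ∈ T := by simp [hT, hf, ReflTransGen.refl]
  have h1 : lam * T.card ≤ ((∑ g ∈ T, loadOf a g : ℕ) : ℚ) := by
    rw [sum_loadOf]
    refine hall T (Finset.filter_subset _ _) ⟨f, hfT⟩ _ ?_
    intro ω hω g hg hE
    simp only [hT, Finset.mem_filter, Finset.mem_univ, true_and] at hg ⊢
    obtain ⟨f', hf', hr'⟩ := h.exists_reach hE hg.2
    obtain ⟨f'', hf''S, hf''⟩ := hclosed ω hω g hg.1 hE
    have : f' = f'' := Option.some.inj (hf'.symm.trans hf'')
    subst this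
    exact ⟨f', ⟨hf''S, hr'⟩, hf'⟩
  have h2 : ∑ g ∈ T, loadOf a g < ∑ _g ∈ T, (loadOf a f + 1) := by
    refine Finset.sum_lt_sum (fun g hg => ?_) ⟨f, hfT, Nat.lt_succ_self _⟩
    exact h.loadOf_le hpos (Finset.mem_filter.1 hg).2
  rw [Finset.sum_const, smul_eq_mul] at h2
  have h3 : ((∑ g ∈ T, loadOf a g : ℕ) : ℚ) < T.card * (loadOf a f + 1) := by exact_mod_cast h2
  have h4 : (0 : ℚ) < T.card := by exact_mod_cast Finset.card_pos.2 ⟨f, hfT⟩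
  have h5 : lam * T.card < (loadOf a f + 1) * T.card := by linarith
  have := lt_of_mul_lt_mul_right h5 h4.le
  linarith

/-- If every `T ⊆ S` attracts at least `lam * |T|` clients of `W`, where `|W| ≤ lam * |S|`, and `S`
serves only clients of `W`, then all loads in `S` are below `lam + 1`: the facilities of `S` that
cannot be reached from `f` attract none of the clients served by the others. -/
theorem IsStable.loadOf_lt (h : IsStable E pos K a) (hpos : ∀ f, pos f < K)
    (S : Finset F) (W : Finset Ω) (lam : ℚ)
    (hclosed : ∀ ω, ∀ f ∈ S, a ω = some f → ω ∈ W) (hW : (W.card : ℚ) ≤ lam * S.card)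
    (hall : ∀ T ⊆ S, T.Nonempty → ∀ X : Finset Ω, (∀ ω ∈ W, ∀ f ∈ T, E ω f → ω ∈ X) →
      lam * T.card ≤ X.card)
    {f : F} (hf : f ∈ S) : (loadOf a f : ℚ) < lam + 1 := by
  classical
  set R := S.filter fun g => ReflTransGen (Passes E a) f g with hR
  set P := S.filter fun g => ¬ ReflTransGen (Passes E a) f g with hP
  set X := W.filter fun ω => ∃ g ∈ P, E ω g with hX
  have hfR : f ∈ R := by simp [hR, hf, ReflTransGen.refl]
  have hPR : R.card + P.card = S.card := Finset.card_filter_add_card_filter_not _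
  have h1 : lam * P.card ≤ X.card := by
    rcases P.eq_empty_or_nonempty with h0 | h0
    · rw [h0]; simp
    · refine hall P (Finset.filter_subset _ _) h0 _ ?_
      intro ω hω g hg hE
      exact Finset.mem_filter.2 ⟨hω, g, hg, hE⟩
  have h2 : (∑ g ∈ R, loadOf a g) + X.card ≤ W.card := by
    rw [sum_loadOf, ← Finset.card_union_of_disjoint]
    · refine Finset.card_le_card (Finset.union_subset ?_ (Finset.filter_subset _ _))
      intro ω hω
      simp only [Finset.mem_filter, Finset.mem_univ, true_and] at hω
      obtain ⟨g, hg, hag⟩ := hω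
      exact hclosed ω g (Finset.mem_filter.1 hg).1 hag
    · rw [Finset.disjoint_left]
      intro ω hω hωX
      simp only [Finset.mem_filter, Finset.mem_univ, true_and] at hω
      obtain ⟨g, hg, hag⟩ := hω
      obtain ⟨-, p, hp, hE⟩ := Finset.mem_filter.1 hωX
      exact (Finset.mem_filter.1 hp).2
        (ReflTransGen.tail (Finset.mem_filter.1 hg).2 ⟨ω, hag, hE⟩)
  have h3 : ∑ _g ∈ R, loadOf a f < ∑ g ∈ R, (loadOf a g + 1) := by
    refine Finset.sum_lt_sum (fun g hg => ?_) ⟨f, hfR, Nat.lt_succ_self _⟩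
    exact h.loadOf_le hpos (Finset.mem_filter.1 hg).2
  rw [Finset.sum_add_distrib, Finset.sum_const, Finset.sum_const, smul_eq_mul, smul_eq_mul,
    mul_one] at h3
  have h2' : ((∑ g ∈ R, loadOf a g : ℕ) : ℚ) + X.card ≤ W.card := by exact_mod_cast h2
  have h3' : (R.card : ℚ) * loadOf a f < ((∑ g ∈ R, loadOf a g : ℕ) : ℚ) + R.card := by
    exact_mod_cast h3
  have hPR' : (R.card : ℚ) + P.card = S.card := by exact_mod_cast hPR
  have h4 : (0 : ℚ) < R.card := by exact_mod_cast Finset.card_pos.2 ⟨f, hfR⟩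
  have h5 : (loadOf a f : ℚ) * R.card < (lam + 1) * R.card := by
    rw [← hPR'] at hW
    nlinarith
  exact lt_of_mul_lt_mul_right h5 h4.le

end Stable

/-! ### The class decomposition -/

namespace FLG

variable {n k : ℕ} (I : FLG n k) (s : Fin k → Fin n)

theorem mem_attraction {X : Finset (Fin k)} {v : Fin n} :
    v ∈ I.attraction s X ↔ ∃ f ∈ X, f ∈ I.range s v := by
  simp [attraction]

theorem Unweighted.weight {I : FLG n k} (h : I.Unweighted) (X : Finset (Fin n)) :
    I.weight X = X.card := by
  simp [FLG.weight, h _]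

theorem exists_isMNS {Fs : Finset (Fin k)} (Vs : Finset (Fin n)) (hF : Fs.Nonempty) :
    ∃ T, I.IsMNS s Fs Vs T := by
  classical
  obtain ⟨T₀, hT₀, hmin⟩ := Finset.exists_min_image (Fs.powerset.filter fun T => T.Nonempty)
    (I.ratio s Vs) ⟨Fs, by simp [hF]⟩
  have h₀ : I.IsMinRatio s Fs Vs T₀ := by
    simp only [Finset.mem_filter, Finset.mem_powerset] at hT₀ hmin
    exact ⟨hT₀, fun T' h1 h2 => hmin T' ⟨h1, h2⟩⟩
  obtain ⟨T, hT, hmax⟩ := Finset.exists_max_image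
    (Finset.univ.filter fun T => I.IsMinRatio s Fs Vs T) Finset.card ⟨T₀, by simp [h₀]⟩
  simp only [Finset.mem_filter, Finset.mem_univ, true_and] at hT hmax
  exact ⟨T, hT, hmax⟩

theorem isMNS_mns {Fs : Finset (Fin k)} (Vs : Finset (Fin n)) (hF : Fs.Nonempty) :
    I.IsMNS s Fs Vs (I.mns s Fs Vs) := by
  have h := I.exists_isMNS s Vs hF
  rw [mns, dif_pos h]
  exact h.choose_spec

theorem mns_subset (Fs : Finset (Fin k)) (Vs : Finset (Fin n)) : I.mns s Fs Vs ⊆ Fs := by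
  unfold mns
  split_ifs with h
  · exact h.choose_spec.1.1.1
  · simp

theorem classified_succ_fst (i : ℕ) :
    (I.classified s (i + 1)).1 = (I.classified s i).1 ∪ I.classF s i := rfl

theorem classified_succ_snd (i : ℕ) :
    (I.classified s (i + 1)).2 = (I.classified s i).2 ∪ I.classV s i := rfl

theorem classF_subset (i : ℕ) : I.classF s i ⊆ Finset.univ \ (I.classified s i).1 :=
  I.mns_subset s _ _

theorem mem_classified_fst {i : ℕ} {f : Fin k} :
    f ∈ (I.classified s i).1 ↔ ∃ j < i, f ∈ I.classF s j := by
  induction i with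
  | zero => simp [classified]
  | succ i ih =>
    rw [classified_succ_fst, Finset.mem_union, ih]
    simp only [Nat.lt_succ_iff_lt_or_eq, or_and_right, exists_or, exists_eq_left]

theorem mem_classified_snd {i : ℕ} {v : Fin n} :
    v ∈ (I.classified s i).2 ↔ ∃ j < i, ∃ f ∈ I.range s v, f ∈ I.classF s j := by
  induction i with
  | zero => simp [classified]
  | succ i ih =>
    rw [classified_succ_snd, Finset.mem_union, classV, Finset.mem_sdiff, ih, mem_attraction]
    simp only [Nat.lt_succ_iff_lt_or_eq, or_and_right, exists_or, exists_eq_left]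
    constructor
    · rintro (h | ⟨⟨f, h1, h2⟩, -⟩)
      · exact Or.inl h
      · exact Or.inr ⟨f, h2, h1⟩
    · rintro (h | ⟨f, h1, h2⟩)
      · exact Or.inl h
      · by_cases h3 : ∃ j < i, ∃ f ∈ I.range s v, f ∈ I.classF s j
        · exact Or.inl h3
        · exact Or.inr ⟨⟨f, h2, h1⟩, h3⟩

theorem classF_unique {i j : ℕ} {f : Fin k} (hi : f ∈ I.classF s i) (hj : f ∈ I.classF s j) :
    i = j := by
  have key : ∀ {i j : ℕ}, f ∈ I.classF s i → f ∈ I.classF s j → ¬ i < j := by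
    intro i j hi hj hlt
    have := I.classF_subset s j hj
    exact (Finset.mem_sdiff.1 this).2 ((I.mem_classified_fst s).2 ⟨i, hlt, hi⟩)
  have h1 := key hi hj
  have h2 := key hj hi
  omega

theorem classF_nonempty {i : ℕ} (h : (Finset.univ \ (I.classified s i).1).Nonempty) :
    (I.classF s i).Nonempty :=
  (I.isMNS_mns s _ h).1.1.2

theorem exists_classF (f : Fin k) : ∃ i, f ∈ I.classF s i := by
  by_contra! hf
  have hmem : ∀ i, f ∈ Finset.univ \ (I.classified s i).1 := by
    intro i
    rw [Finset.mem_sdiff, mem_classified_fst]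
    exact ⟨Finset.mem_univ _, fun ⟨j, _, hj⟩ => hf j hj⟩
  have hcard : ∀ i, i ≤ (I.classified s i).1.card := by
    intro i
    induction i with
    | zero => simp
    | succ i ih =>
      rw [classified_succ_fst, Finset.card_union_of_disjoint]
      · have := (I.classF_nonempty s ⟨f, hmem i⟩).card_pos
        omega
      · rw [Finset.disjoint_right]
        intro g hg
        exact (Finset.mem_sdiff.1 (I.classF_subset s i hg)).2
  have h1 := hcard (k + 1)
  have h2 := Finset.card_le_univ (I.classified s (k + 1)).1
  rw [Fintype.card_fin] at h2
  omega

/-- A client belongs to the first of the classes of the facilities in her shopping range. -/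
theorem mem_classV {i : ℕ} {v : Fin n} :
    v ∈ I.classV s i ↔ (∃ f ∈ I.range s v, f ∈ I.classF s i) ∧
      ∀ f ∈ I.range s v, ∀ j, f ∈ I.classF s j → i ≤ j := by
  rw [classV, Finset.mem_sdiff, mem_attraction, mem_classified_snd]
  constructor
  · rintro ⟨⟨f, h1, h2⟩, h3⟩
    refine ⟨⟨f, h2, h1⟩, fun g hg j hj => ?_⟩
    by_contra! hlt
    exact h3 ⟨j, hlt, g, hg, hj⟩
  · rintro ⟨⟨f, h1, h2⟩, h3⟩
    refine ⟨⟨f, h2, h1⟩, ?_⟩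
    rintro ⟨j, hj, g, hg, hgj⟩
    have := h3 g hg j hgj
    omega

theorem classV_unique {i j : ℕ} {v : Fin n} (hi : v ∈ I.classV s i) (hj : v ∈ I.classV s j) :
    i = j := by
  rw [mem_classV] at hi hj
  obtain ⟨⟨f, hf, hfi⟩, hi'⟩ := hi
  obtain ⟨⟨g, hg, hgj⟩, hj'⟩ := hj
  exact le_antisymm (hi' g hg j hgj) (hj' f hf i hfi)

theorem exists_classV {v : Fin n} {f : Fin k} (hf : f ∈ I.range s v) :
    ∃ i, v ∈ I.classV s i := by
  classical
  have hex : ∃ i, ∃ f ∈ I.range s v, f ∈ I.classF s i := by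
    obtain ⟨i, hi⟩ := I.exists_classF s f
    exact ⟨i, f, hf, hi⟩
  refine ⟨Nat.find hex, (I.mem_classV s).2 ⟨Nat.find_spec hex, fun g hg j hj => ?_⟩⟩
  exact Nat.find_min' hex ⟨g, hg, hj⟩

theorem attraction_inter_eq_classV (i : ℕ) :
    I.attraction s (I.classF s i) ∩ (Finset.univ \ (I.classified s i).2) = I.classV s i := by
  ext v
  simp [classV]

variable {I}

/-- The defining minimality of the `i`-th class, as a lower bound on the number of unclassified
clients that a set of unclassified facilities attracts. -/
theorem Unweighted.classLoad_mul_card_le (hI : I.Unweighted) {i : ℕ} {T : Finset (Fin k)}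
    (hT : T ⊆ Finset.univ \ (I.classified s i).1) :
    I.classLoad s i * T.card ≤
      ((I.attraction s T ∩ (Finset.univ \ (I.classified s i).2)).card : ℚ) := by
  rcases T.eq_empty_or_nonempty with rfl | hne
  · simp
  have h := (I.isMNS_mns s (Finset.univ \ (I.classified s i).2) (hne.mono hT)).1.2 T hT hne
  have hc : (0 : ℚ) < T.card := by exact_mod_cast hne.card_pos
  change I.ratio s _ (I.classF s i) ≤ _ at h
  rw [ratio, attraction_inter_eq_classV] at h
  change I.classLoad s i ≤ _ at h
  rwa [ratio, le_div_iff₀ hc, hI.weight] at h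

theorem Unweighted.classLoad_mul_card (hI : I.Unweighted) {i : ℕ} (h : (I.classF s i).Nonempty) :
    I.classLoad s i * (I.classF s i).card = (I.classV s i).card := by
  have : ((I.classF s i).card : ℚ) ≠ 0 := by exact_mod_cast h.card_pos.ne'
  rw [classLoad, hI.weight, div_mul_cancel₀ _ this]

theorem Unweighted.classLoad_lt_succ (hI : I.Unweighted) {i : ℕ}
    (h : (I.classF s (i + 1)).Nonempty) : I.classLoad s i < I.classLoad s (i + 1) := by
  have hsub := I.classF_subset s (i + 1)
  have hne : (Finset.univ \ (I.classified s i).1).Nonempty := by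
    obtain ⟨f, hf⟩ := h
    refine ⟨f, ?_⟩
    have := hsub hf
    rw [classified_succ_fst] at this
    simp only [Finset.mem_sdiff, Finset.mem_univ, true_and, Finset.mem_union, not_or] at this ⊢
    exact this.1
  have hFi := I.classF_nonempty s hne
  by_contra! hle
  -- Otherwise the union of the two classes would be a larger set of minimum ratio.
  have hdisj : Disjoint (I.classF s i) (I.classF s (i + 1)) := by
    rw [Finset.disjoint_left]
    intro f h1 h2
    have := I.classF_unique s h1 h2
    omega
  have hdisjV : Disjoint (I.classV s i) (I.classV s (i + 1)) := by
    rw [Finset.disjoint_left]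
    intro f h1 h2
    have := I.classV_unique s h1 h2
    omega
  have hattr : I.attraction s (I.classF s i ∪ I.classF s (i + 1)) ∩
      (Finset.univ \ (I.classified s i).2) = I.classV s i ∪ I.classV s (i + 1) := by
    ext v
    simp only [Finset.mem_inter, Finset.mem_sdiff, Finset.mem_univ, true_and, Finset.mem_union,
      classV, classified_succ_snd, mem_attraction]
    constructor
    · rintro ⟨⟨f, hf | hf, hfv⟩, h2⟩
      · exact Or.inl ⟨⟨f, hf, hfv⟩, h2⟩
      · by_cases h3 : ∃ f ∈ I.classF s i, f ∈ I.range s v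
        · exact Or.inl ⟨h3, h2⟩
        · exact Or.inr ⟨⟨f, hf, hfv⟩, fun h => h.elim h2 fun h => h3 h.1⟩
    · rintro (⟨⟨f, hf, hfv⟩, h2⟩ | ⟨⟨f, hf, hfv⟩, h2⟩)
      · exact ⟨⟨f, Or.inl hf, hfv⟩, h2⟩
      · exact ⟨⟨f, Or.inr hf, hfv⟩, fun h => h2 (Or.inl h)⟩
  have hmns := I.isMNS_mns s (Finset.univ \ (I.classified s i).2) hne
  change I.IsMNS s _ _ (I.classF s i) at hmns
  have hcard := hmns.2 (I.classF s i ∪ I.classF s (i + 1)) ⟨⟨?_, ?_⟩, ?_⟩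
  · rw [Finset.card_union_of_disjoint hdisj] at hcard
    have := h.card_pos
    omega
  · refine Finset.union_subset (I.classF_subset s i) (hsub.trans ?_)
    rw [classified_succ_fst]
    exact Finset.sdiff_subset_sdiff le_rfl Finset.subset_union_left
  · exact hFi.mono Finset.subset_union_left
  · intro T' hT' hT'ne
    refine le_trans ?_ (hmns.1.2 T' hT' hT'ne)
    have e1 := hI.classLoad_mul_card s hFi
    have e2 := hI.classLoad_mul_card s h
    have p1 : (0 : ℚ) < (I.classF s i).card := by exact_mod_cast hFi.card_pos
    have p2 : (0 : ℚ) < (I.classF s (i + 1)).card := by exact_mod_cast h.card_pos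
    rw [ratio, ratio, hattr, attraction_inter_eq_classV, hI.weight, hI.weight,
      Finset.card_union_of_disjoint hdisj, Finset.card_union_of_disjoint hdisjV]
    push_cast
    rw [div_le_div_iff₀ (by positivity) p1, ← e1, ← e2]
    nlinarith [mul_le_mul_of_nonneg_right hle (mul_pos p1 p2).le]

theorem Unweighted.classLoad_lt (hI : I.Unweighted) {i j : ℕ} (hij : i < j)
    (h : (I.classF s j).Nonempty) : I.classLoad s i < I.classLoad s j := by
  induction j, hij using Nat.le_induction with
  | base => exact hI.classLoad_lt_succ s h
  | succ j hj ih =>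
    refine (ih ?_).trans (hI.classLoad_lt_succ s h)
    refine I.classF_nonempty s ?_
    obtain ⟨f, hf⟩ := h
    refine ⟨f, ?_⟩
    have := I.classF_subset s (j + 1) hf
    rw [classified_succ_fst] at this
    simp only [Finset.mem_sdiff, Finset.mem_univ, true_and, Finset.mem_union, not_or] at this ⊢
    exact this.1

/-- Class loads are fractions with denominators at most `k`, so that distinct ones differ by at least
`1 / k ^ 2`. -/
theorem Unweighted.classLoad_gap (hI : I.Unweighted) {i j : ℕ} (hij : i < j)
    (hi : (I.classF s i).Nonempty) (hj : (I.classF s j).Nonempty) :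
    (k ^ 2 : ℚ) * I.classLoad s i + 1 ≤ k ^ 2 * I.classLoad s j := by
  have hlt := hI.classLoad_lt s hij hj
  have e1 := hI.classLoad_mul_card s hi
  have e2 := hI.classLoad_mul_card s hj
  have p1 : (0 : ℚ) < (I.classF s i).card := by exact_mod_cast hi.card_pos
  have p2 : (0 : ℚ) < (I.classF s j).card := by exact_mod_cast hj.card_pos
  have q1 : ((I.classF s i).card : ℚ) ≤ k := by
    exact_mod_cast (Finset.card_le_univ _).trans_eq (Fintype.card_fin k)
  have q2 : ((I.classF s j).card : ℚ) ≤ k := by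
    exact_mod_cast (Finset.card_le_univ _).trans_eq (Fintype.card_fin k)
  have h1 : (I.classV s i).card * (I.classF s j).card + 1 ≤
      (I.classV s j).card * (I.classF s i).card := by
    have : ((I.classV s i).card * (I.classF s j).card : ℚ) <
        (I.classV s j).card * (I.classF s i).card := by
      rw [← e1, ← e2]
      nlinarith [mul_lt_mul_of_pos_right hlt (mul_pos p1 p2)]
    exact_mod_cast this
  have h1' : ((I.classV s i).card * (I.classF s j).card : ℚ) + 1 ≤
      (I.classV s j).card * (I.classF s i).card := by exact_mod_cast h1
  rw [← e1, ← e2] at h1'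
  have h2 : 1 ≤ (I.classLoad s j - I.classLoad s i) *
      ((I.classF s i).card * (I.classF s j).card) := by linarith
  have h3 : ((I.classF s i).card * (I.classF s j).card : ℚ) ≤ k ^ 2 := by
    rw [sq]
    exact mul_le_mul q1 q2 p2.le (p1.le.trans q1)
  have h4 := mul_le_mul_of_nonneg_left h3 (sub_nonneg.2 hlt.le)
  linarith

end FLG

/-! ### Classes from a stable assignment of client copies -/

namespace FLG

variable {n k : ℕ} {I : FLG n k} {s : Fin k → Fin n}

section Copies

variable {Ω : Type*} [Fintype Ω] {o : Ω → Fin n} {c : ℕ} {pos : Fin k → ℕ}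
  {a : Ω → Option (Fin k)}

/-- When every client is replaced by `c ≥ 4 * k ^ 2` copies (`o` maps a copy to its original), the
loads of a stable assignment determine the class loads up to an error that is smaller than the gaps
between different classes. -/
theorem Unweighted.loadOf_copies (hI : I.Unweighted)
    (ho : ∀ X : Finset (Fin n), (Finset.univ.filter fun ω => o ω ∈ X).card = c * X.card)
    (hc : 4 * k ^ 2 ≤ c) (hpos : ∀ f, pos f < k)
    (h : IsStable (fun ω f => f ∈ I.range s (o ω)) pos k a) {i : ℕ} {f : Fin k}
    (hf : f ∈ I.classF s i) :
    (c : ℚ) * I.classLoad s i - 1 < loadOf a f ∧ (loadOf a f : ℚ) < c * I.classLoad s i + 1 := by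
  have hall : ∀ i, ∀ T ⊆ Finset.univ \ (I.classified s i).1, ∀ X : Finset Ω,
      (∀ ω, o ω ∈ I.attraction s T ∩ (Finset.univ \ (I.classified s i).2) → ω ∈ X) →
      (c : ℚ) * I.classLoad s i * T.card ≤ X.card := by
    intro i T hT X hX
    have h1 := hI.classLoad_mul_card_le s hT
    have h2 : c * (I.attraction s T ∩ (Finset.univ \ (I.classified s i).2)).card ≤ X.card := by
      rw [← ho]
      exact Finset.card_le_card fun ω hω => hX ω (Finset.mem_filter.1 hω).2
    have h2' : (c : ℚ) * (I.attraction s T ∩ (Finset.univ \ (I.classified s i).2)).card ≤ X.card := by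
      exact_mod_cast h2
    have := mul_le_mul_of_nonneg_left h1 (Nat.cast_nonneg (α := ℚ) c)
    linarith
  have hlow : ∀ i f, f ∈ I.classF s i → (c : ℚ) * I.classLoad s i - 1 < loadOf a f := by
    intro i f hf
    refine h.lt_loadOf hpos (Finset.univ \ (I.classified s i).1)
      (Finset.univ.filter fun ω => o ω ∈ Finset.univ \ (I.classified s i).2) _ ?_ ?_
      (I.classF_subset s i hf)
    · intro ω hω f _ hE
      obtain ⟨g, hg⟩ := h.served ω f hE
      refine ⟨g, ?_, hg⟩
      have hgE := h.edge ω g hg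
      simp only [Finset.mem_filter, Finset.mem_sdiff, Finset.mem_univ, true_and,
        mem_classified_snd, mem_classified_fst] at hω ⊢
      rintro ⟨j, hj, hgj⟩
      exact hω ⟨j, hj, g, hgE, hgj⟩
    · intro T hT _ X hX
      refine hall i T hT X fun ω hω => ?_
      rw [Finset.mem_inter, mem_attraction] at hω
      obtain ⟨⟨g, hgT, hg⟩, hω⟩ := hω
      exact hX ω (by simpa using hω) g hgT hg
  refine ⟨hlow i f hf, ?_⟩
  induction i using Nat.strong_induction_on generalizing f with
  | _ i ih =>
  have hne : (I.classF s i).Nonempty := ⟨f, hf⟩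
  refine h.loadOf_lt hpos (I.classF s i) (Finset.univ.filter fun ω => o ω ∈ I.classV s i) _
    ?_ ?_ ?_ hf
  · intro ω g hg hag
    have hE := h.edge ω g hag
    obtain ⟨j, hj⟩ := I.exists_classV s hE
    obtain ⟨⟨g', hg', hg'j⟩, hle⟩ := (I.mem_classV s).1 hj
    rcases (hle g hE i hg).lt_or_eq with hlt | rfl
    · exfalso
      have h1 := ih j hlt hg'j
      have h2 := hlow i g hg
      have h3 : loadOf a g ≤ loadOf a g' + 1 :=
        h.loadOf_le hpos (Relation.ReflTransGen.single ⟨ω, hag, hg'⟩)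
      have h4 := hI.classLoad_gap s hlt ⟨g', hg'j⟩ hne
      have h5 := hI.classLoad_lt s hlt hne
      have h3' : (loadOf a g : ℚ) ≤ loadOf a g' + 1 := by exact_mod_cast h3
      have hc' : (4 * k ^ 2 : ℚ) ≤ c := by exact_mod_cast hc
      have := mul_le_mul_of_nonneg_right hc' (sub_nonneg.2 h5.le)
      nlinarith
    · simpa using hj
  · rw [ho, mul_assoc, hI.classLoad_mul_card s hne]
    push_cast
    exact le_rfl
  · intro T hT _ X hX
    refine hall i T (hT.trans (I.classF_subset s i)) X fun ω hω => ?_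
    have hω' : o ω ∈ I.classV s i := by
      rw [← attraction_inter_eq_classV]
      rw [Finset.mem_inter, mem_attraction] at hω ⊢
      obtain ⟨⟨g, hgT, hg⟩, hω⟩ := hω
      exact ⟨⟨g, hT hgT, hg⟩, hω⟩
    rw [Finset.mem_inter, mem_attraction] at hω
    obtain ⟨⟨g, hgT, hg⟩, -⟩ := hω
    exact hX ω (by simpa using hω') g hgT hg

/-- Client `v` may patronize `f`, and both belong to the same class. -/
def ClassEdge (I : FLG n k) (s : Fin k → Fin n) (v : Fin n) (f : Fin k) : Prop :=
  f ∈ I.range s v ∧ ∃ i, v ∈ I.classV s i ∧ f ∈ I.classF s i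

/-- In a stable assignment of client copies, the edges within the classes are those that lead to an
almost minimal load. -/
theorem Unweighted.classEdge_iff (hI : I.Unweighted)
    (ho : ∀ X : Finset (Fin n), (Finset.univ.filter fun ω => o ω ∈ X).card = c * X.card)
    (hc : 4 * k ^ 2 ≤ c) (hpos : ∀ f, pos f < k)
    (h : IsStable (fun ω f => f ∈ I.range s (o ω)) pos k a) (v : Fin n) (f : Fin k) :
    I.ClassEdge s v f ↔ f ∈ I.range s v ∧ ∀ g ∈ I.range s v,
      k * loadOf a f + pos f ≤ k * loadOf a g + pos g + 2 * k := by
  have hload := fun i f => hI.loadOf_copies (f := f) (i := i) ho hc hpos h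
  have hc' : (4 * k ^ 2 : ℚ) ≤ c := by exact_mod_cast hc
  -- Loads in different classes differ by at least three, those in one class by at most one.
  have hsep : ∀ i j f g, i < j → f ∈ I.classF s i → g ∈ I.classF s j →
      loadOf a f + 3 ≤ loadOf a g := by
    intro i j f g hij hf hg
    have h1 := (hload i f hf).2
    have h2 := (hload j g hg).1
    have h4 := hI.classLoad_gap s hij ⟨f, hf⟩ ⟨g, hg⟩
    have h5 := hI.classLoad_lt s hij ⟨g, hg⟩
    have h6 := mul_le_mul_of_nonneg_right hc' (sub_nonneg.2 h5.le)
    have h7 : (loadOf a f : ℚ) + 2 < loadOf a g := by nlinarith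
    exact_mod_cast h7
  have hkey : ∀ f g, loadOf a f ≤ loadOf a g + 1 →
      k * loadOf a f + pos f ≤ k * loadOf a g + pos g + 2 * k := by
    intro f g hfg
    have h1 := Nat.mul_le_mul_left k hfg
    have h2 := hpos f
    rw [mul_add] at h1
    omega
  constructor
  · rintro ⟨hf, i, hv, hfi⟩
    refine ⟨hf, fun g hg => hkey f g ?_⟩
    obtain ⟨j, hj⟩ := I.exists_classF s g
    rcases (((I.mem_classV s).1 hv).2 g hg j hj).lt_or_eq with hlt | rfl
    · have := hsep i j f g hlt hfi hj
      omega
    · have h1 := (hload i f hfi).2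
      have h2 := (hload i g hj).1
      have h3 : (loadOf a f : ℚ) < loadOf a g + 2 := by linarith
      have h3' : loadOf a f < loadOf a g + 2 := by exact_mod_cast h3
      omega
  · rintro ⟨hf, hle⟩
    obtain ⟨i, hv⟩ := I.exists_classV s hf
    obtain ⟨j, hj⟩ := I.exists_classF s f
    obtain ⟨⟨g, hg, hgi⟩, hmin⟩ := (I.mem_classV s).1 hv
    rcases (hmin f hf j hj).lt_or_eq with hlt | rfl
    · exfalso
      have h1 := hsep i j g f hlt hgi hj
      have h2 := hle g hg
      have h3 := hpos g
      have h4 := Nat.mul_le_mul_left k h1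
      rw [mul_add] at h4
      omega
    · exact ⟨hf, i, hv, hj⟩

end Copies

/-! ### Favoring equilibria from a stable assignment within the classes -/

section Favoring

variable {π : Equiv.Perm (Fin k)} {a : Fin n → Option (Fin k)}

theorem Unweighted.load_assignmentProfile (hI : I.Unweighted) (f : Fin k) :
    I.load (assignmentProfile a) f = loadOf a f := by
  simp [load, loadOf, assignmentProfile, hI _]

theorem Unweighted.loadOf_class (hI : I.Unweighted) {pos : Fin k → ℕ} (hpos : ∀ f, pos f < k)
    (h : IsStable (I.ClassEdge s) pos k a) {i : ℕ} {f : Fin k} (hf : f ∈ I.classF s i) :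
    ⌊I.classLoad s i⌋ ≤ (loadOf a f : ℤ) ∧ (loadOf a f : ℤ) ≤ ⌈I.classLoad s i⌉ := by
  have hne : (I.classF s i).Nonempty := ⟨f, hf⟩
  have hall : ∀ T ⊆ I.classF s i, T.Nonempty → ∀ X : Finset (Fin n),
      (∀ v ∈ I.classV s i, ∀ f ∈ T, I.ClassEdge s v f → v ∈ X) →
      I.classLoad s i * T.card ≤ X.card := by
    intro T hT _ X hX
    refine (hI.classLoad_mul_card_le s (hT.trans (I.classF_subset s i))).trans ?_
    refine Nat.cast_le.2 (Finset.card_le_card fun v hv => ?_)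
    have hv' : v ∈ I.classV s i := by
      rw [← attraction_inter_eq_classV]
      rw [Finset.mem_inter, mem_attraction] at hv ⊢
      obtain ⟨⟨g, hgT, hg⟩, hω⟩ := hv
      exact ⟨⟨g, hT hgT, hg⟩, hω⟩
    rw [Finset.mem_inter, mem_attraction] at hv
    obtain ⟨⟨g, hgT, hg⟩, -⟩ := hv
    exact hX v hv' g hgT ⟨hg, i, hv', hT hgT⟩
  have h1 := h.lt_loadOf hpos (I.classF s i) (I.classV s i) (I.classLoad s i) ?_ hall hf
  have h2 := h.loadOf_lt hpos (I.classF s i) (I.classV s i) (I.classLoad s i) ?_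
    (hI.classLoad_mul_card s hne).ge hall hf
  · have h3 := Int.floor_le (I.classLoad s i)
    have h4 := Int.le_ceil (I.classLoad s i)
    have h5 : ((⌊I.classLoad s i⌋ : ℤ) : ℚ) < ((loadOf a f : ℤ) + 1 : ℤ) := by
      push_cast; linarith
    have h6 : (((loadOf a f : ℤ) : ℤ) : ℚ) < (⌈I.classLoad s i⌉ + 1 : ℤ) := by
      push_cast; linarith
    rw [Int.cast_lt] at h5 h6
    omega
  · intro v g hg hag
    obtain ⟨_, j, hv, hgj⟩ := h.edge v g hag
    rwa [I.classF_unique s hg hgj]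
  · intro v hv g _ hE
    obtain ⟨g', hg'⟩ := h.served v g hE
    refine ⟨g', ?_, hg'⟩
    obtain ⟨_, j, hv', hgj⟩ := h.edge v g' hg'
    rwa [I.classV_unique s hv hv']

theorem Unweighted.loadOf_class_eq (hI : I.Unweighted) {pos : Fin k → ℕ} (hpos : ∀ f, pos f < k)
    (h : IsStable (I.ClassEdge s) pos k a) {i : ℕ} {f : Fin k} (hf : f ∈ I.classF s i) :
    (loadOf a f : ℤ) = ⌊I.classLoad s i⌋ ∨ (loadOf a f : ℤ) = ⌈I.classLoad s i⌉ := by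
  have h1 := hI.loadOf_class hpos h hf
  have h2 := Int.ceil_le_floor_add_one (I.classLoad s i)
  omega

theorem feasible_assignmentProfile {pos : Fin k → ℕ} (h : IsStable (I.ClassEdge s) pos k a) :
    I.Feasible s (assignmentProfile a) := by
  intro v
  refine ⟨fun f => ?_, fun f hf => ?_, fun ⟨f, hf⟩ => ?_⟩
  · unfold assignmentProfile
    split_ifs <;> norm_num
  · unfold assignmentProfile
    rw [if_neg]
    intro hv
    exact hf (h.edge v f hv).1
  · obtain ⟨i, hi⟩ := I.exists_classV s hf
    obtain ⟨⟨g, hg, hgi⟩, -⟩ := (I.mem_classV s).1 hi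
    obtain ⟨g', hg'⟩ := h.served v g ⟨hg, i, hi, hgi⟩
    unfold assignmentProfile
    rw [hg']
    simp only [Option.some.injEq]
    rw [Finset.sum_ite_eq, if_pos (h.edge v g' hg').1]

theorem Unweighted.isRounded (hI : I.Unweighted) {pos : Fin k → ℕ} (hpos : ∀ f, pos f < k)
    (h : IsStable (I.ClassEdge s) pos k a) : I.IsRounded s (assignmentProfile a) := by
  refine ⟨feasible_assignmentProfile h, fun i f hf => ?_, fun i v hv => ?_⟩
  · rw [hI.load_assignmentProfile]
    rcases hI.loadOf_class_eq hpos h hf with h1 | h1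
    · left; exact_mod_cast h1
    · right; exact_mod_cast h1
  · obtain ⟨⟨g, hg, hgi⟩, -⟩ := (I.mem_classV s).1 hv
    obtain ⟨g', hg'⟩ := h.served v g ⟨hg, i, hv, hgi⟩
    obtain ⟨_, j, hvj, hgj⟩ := h.edge v g' hg'
    refine ⟨g', ⟨?_, ?_⟩, ?_⟩
    · rwa [I.classV_unique s hv hvj]
    · simp [assignmentProfile, hg']
    · rintro g'' ⟨-, h2⟩
      by_contra hne
      rw [assignmentProfile, hg', if_neg fun he => hne (Option.some.inj he).symm] at h2
      norm_num at h2

/-- No client gains by moving: her facility has load at most one above that of any facility in her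
range, since class loads increase and loads are class loads rounded up or down. -/
theorem Unweighted.isClientEquilibrium (hI : I.Unweighted) {pos : Fin k → ℕ}
    (hpos : ∀ f, pos f < k) (h : IsStable (I.ClassEdge s) pos k a) :
    I.IsClientEquilibrium s (assignmentProfile a) := by
  classical
  refine ⟨feasible_assignmentProfile h, fun v τ hτ => ?_⟩
  rw [not_lt]
  have hexcl : ∀ σ : Fin k → ℝ, ∀ f,
      I.loadExcl (Function.update (assignmentProfile a) v σ) v f =
        I.loadExcl (assignmentProfile a) v f := by
    intro σ f
    unfold loadExcl
    refine Finset.sum_congr rfl fun u hu => ?_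
    rw [Function.update_of_ne (Finset.ne_of_mem_erase hu)]
  have hsplit : ∀ f, (loadOf a f : ℝ) =
      I.loadExcl (assignmentProfile a) v f + assignmentProfile a v f := by
    intro f
    rw [← hI.load_assignmentProfile, load, loadExcl,
      ← Finset.sum_erase_add _ _ (Finset.mem_univ v), hI v]
    simp
  unfold waitingTime
  simp only [hexcl, Function.update_self]
  refine add_le_add le_rfl ?_
  rcases (I.range s v).eq_empty_or_nonempty with h0 | hne
  · simp [h0]
  obtain ⟨f, hf⟩ := hne
  obtain ⟨i, hi⟩ := I.exists_classV s hf
  obtain ⟨⟨g, hg, hgi⟩, -⟩ := (I.mem_classV s).1 hi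
  obtain ⟨b, hb⟩ := h.served v g ⟨hg, i, hi, hgi⟩
  obtain ⟨hbr, i', hi', hbi⟩ := h.edge v b hb
  obtain rfl := I.classV_unique s hi hi'
  have hmin : ∀ g ∈ I.range s v,
      I.loadExcl (assignmentProfile a) v b ≤ I.loadExcl (assignmentProfile a) v g := by
    intro g hg
    by_cases hgb : g = b
    · rw [hgb]
    have h1 := hsplit b
    have h2 := hsplit g
    simp only [assignmentProfile, hb, if_true, Option.some.injEq] at h1 h2
    rw [if_neg (Ne.symm hgb)] at h2
    obtain ⟨j, hj⟩ := I.exists_classF s g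
    have hij := ((I.mem_classV s).1 hi).2 g hg j hj
    have h3 := (hI.loadOf_class hpos h hbi).2
    have h4 := (hI.loadOf_class hpos h hj).1
    have h5 : I.classLoad s i ≤ I.classLoad s j := by
      rcases hij.lt_or_eq with hlt | rfl
      · exact (hI.classLoad_lt s hlt ⟨g, hj⟩).le
      · exact le_rfl
    have h6 := Int.floor_le_floor h5
    have h7 := Int.ceil_le_floor_add_one (I.classLoad s i)
    have h8 : (loadOf a b : ℤ) ≤ loadOf a g + 1 := by omega
    have h9 : (loadOf a b : ℝ) ≤ loadOf a g + 1 := by exact_mod_cast h8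
    unfold assignmentProfile at *
    linarith
  have hl : ∑ f ∈ I.range s v, assignmentProfile a v f * I.loadExcl (assignmentProfile a) v f =
      I.loadExcl (assignmentProfile a) v b := by
    rw [Finset.sum_eq_single b]
    · simp [assignmentProfile, hb]
    · intro g _ hgb
      simp [assignmentProfile, hb, Ne.symm hgb]
    · exact fun hn => absurd hbr hn
  rw [hl]
  calc I.loadExcl (assignmentProfile a) v b
      = ∑ f ∈ I.range s v, τ f * I.loadExcl (assignmentProfile a) v b := by
        rw [← Finset.sum_mul, hτ.2.2 ⟨f, hf⟩, one_mul]
    _ ≤ _ := Finset.sum_le_sum fun g hg =>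
        mul_le_mul_of_nonneg_left (hmin g hg) (hτ.1 g).1

theorem Feasible.eq_zero {σ : ClientProfile n k} (hσ : I.Feasible s σ) {v : Fin n} {g f : Fin k}
    (hg : σ v g = 1) (hfg : f ≠ g) : σ v f = 0 := by
  have hgr : g ∈ I.range s v := by
    by_contra hn
    have := (hσ v).2.1 g hn
    rw [this] at hg
    norm_num at hg
  by_cases hfr : f ∈ I.range s v
  · have h1 := (hσ v).2.2 ⟨g, hgr⟩
    have h2 : σ v g + σ v f ≤ ∑ f ∈ I.range s v, σ v f := by
      rw [← Finset.sum_pair hfg.symm]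
      refine Finset.sum_le_sum_of_subset_of_nonneg ?_ fun h _ _ => ((hσ v).1 h).1
      intro x hx
      rcases Finset.mem_insert.1 hx with rfl | hx
      · exact hgr
      · rwa [Finset.mem_singleton.1 hx]
    have h3 := ((hσ v).1 f).1
    linarith
  · exact (hσ v).2.1 f hfr

/-- In a rounded profile clients patronize facilities of their own class only. -/
theorem IsRounded.classEdge {σ : ClientProfile n k} (hσ : I.IsRounded s σ) {v : Fin n} {f : Fin k}
    (hf : σ v f ≠ 0) : I.ClassEdge s v f := by
  have hfr : f ∈ I.range s v := by
    by_contra hn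
    exact hf ((hσ.1 v).2.1 f hn)
  obtain ⟨i, hi⟩ := I.exists_classV s hfr
  obtain ⟨g, ⟨hgi, hg⟩, -⟩ := hσ.2.2 i v hi
  have : f = g := by
    by_contra hne
    exact hf (hσ.1.eq_zero hg hne)
  exact ⟨hfr, i, hi, this ▸ hgi⟩

/-- A stable assignment is lexicographically maximal. Otherwise let `f` be the first facility that a
rounded profile `σ` favors more. The facilities from which `f` can be reached serve all the clients
that they attract, so one of them has a smaller load in `σ`; it comes after `f` in the order
and has load one above that of `f`, so that the chain of passes to `f` is an improvement. -/
theorem Unweighted.isFavoring (hI : I.Unweighted)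
    (h : IsStable (I.ClassEdge s) (fun f => (π.symm f : ℕ)) k a) :
    I.IsFavoring s π (assignmentProfile a) := by
  classical
  have hpos : ∀ f, ((π.symm f : Fin k) : ℕ) < k := fun f => (π.symm f).2
  refine ⟨hI.isClientEquilibrium hpos h, hI.isRounded hpos h, fun σ hσ => ?_⟩
  by_contra hlt
  rw [not_le] at hlt
  obtain ⟨x, hx, hxlt⟩ := hlt
  change ∀ j < x, I.load (assignmentProfile a) (π j) = I.load σ (π j) at hx
  change I.load (assignmentProfile a) (π x) < I.load σ (π x) at hxlt
  simp only [hI.load_assignmentProfile] at hx hxlt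
  set f := π x with hfx
  obtain ⟨i, hfi⟩ := I.exists_classF s f
  set T := Finset.univ.filter fun g => Relation.ReflTransGen (Passes (I.ClassEdge s) a) g f with hT
  have hfT : f ∈ T := by simp [hT, Relation.ReflTransGen.refl]
  have hTi : ∀ g ∈ T, g ∈ I.classF s i := by
    intro g hg
    simp only [hT, Finset.mem_filter, Finset.mem_univ, true_and] at hg
    induction hg using Relation.ReflTransGen.head_induction_on with
    | refl => exact hfi
    | head h1 _ ih =>
      obtain ⟨v, hv, hE⟩ := h1
      obtain ⟨_, j, hvj, hgj⟩ := hE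
      obtain ⟨_, j', hvj', hgj'⟩ := h.edge _ _ hv
      rw [I.classV_unique s hvj hvj'] at hgj
      rwa [I.classF_unique s (ih) hgj]
  have hsum : ∑ g ∈ T, I.load σ g ≤ ∑ g ∈ T, (loadOf a g : ℝ) := by
    rw [← Nat.cast_sum, sum_loadOf, ← Finset.sum_boole]
    unfold load
    rw [Finset.sum_comm]
    refine Finset.sum_le_sum fun v _ => ?_
    rw [← Finset.sum_mul, hI v, Rat.cast_one, mul_one]
    by_cases hz : ∀ g ∈ T, σ v g = 0
    · rw [Finset.sum_eq_zero hz]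
      split_ifs <;> norm_num
    push Not at hz
    obtain ⟨g, hgT, hg⟩ := hz
    have hE := hσ.classEdge hg
    obtain ⟨g', hg', hr⟩ := h.exists_reach hE (Finset.mem_filter.1 hgT).2
    rw [if_pos ⟨g', Finset.mem_filter.2 ⟨Finset.mem_univ _, hr⟩, hg'⟩, ← (hσ.1 v).2.2 ⟨g, hE.1⟩]
    have hzero : ∀ g ∈ T, g ∉ I.range s v → σ v g = 0 := fun g _ hn => (hσ.1 v).2.1 g hn
    rw [← Finset.sum_filter_of_ne (p := fun g => g ∈ I.range s v)
      (fun g hg hne => by by_contra hn; exact hne (hzero g hg hn))]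
    refine Finset.sum_le_sum_of_subset_of_nonneg ?_ fun h _ _ => ((hσ.1 v).1 h).1
    intro g hg
    exact (Finset.mem_filter.1 hg).2
  obtain ⟨g, hgT, hg⟩ : ∃ g ∈ T, I.load σ g < loadOf a g := by
    by_contra! hle
    exact absurd hsum (not_le.2 (Finset.sum_lt_sum hle ⟨f, hfT, hxlt⟩))
  have hgi := hTi g hgT
  have hposlt : x < π.symm g := by
    by_contra! hle
    rcases hle.lt_or_eq with hlt | heq
    · have := hx _ hlt
      rw [π.apply_symm_apply] at this
      linarith
    · rw [← heq, π.apply_symm_apply] at hfx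
      rw [hfx] at hxlt
      linarith
  have hstep : loadOf a f + 1 ≤ loadOf a g := by
    have hceil := Int.ceil_le_floor_add_one (I.classLoad s i)
    have h1 : (loadOf a f : ℤ) = ⌊I.classLoad s i⌋ ∧ ⌊I.classLoad s i⌋ < ⌈I.classLoad s i⌉ := by
      have hb := hI.loadOf_class hpos h hfi
      have hlt : (loadOf a f : ℤ) < ⌈I.classLoad s i⌉ := by
        have h2 := Int.floor_le_ceil (I.classLoad s i)
        rcases hσ.2.1 i f hfi with h3 | h3 <;> rw [h3] at hxlt
        · have : (loadOf a f : ℤ) < ⌊I.classLoad s i⌋ := by exact_mod_cast hxlt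
          omega
        · exact_mod_cast hxlt
      omega
    have h2 : ⌊I.classLoad s i⌋ < (loadOf a g : ℤ) := by
      rcases hσ.2.1 i g hgi with h3 | h3 <;> rw [h3] at hg
      · exact_mod_cast hg
      · have : ⌈I.classLoad s i⌉ < (loadOf a g : ℤ) := by exact_mod_cast hg
        omega
    omega
  have hst := h.stable g f (Finset.mem_filter.1 hgT).2
  have h1 := Nat.mul_le_mul_left k hstep
  have h2 : (x : ℕ) < (π.symm g : ℕ) := hposlt
  simp only [hfx, π.symm_apply_apply] at hst h1
  rw [mul_add, mul_one] at h1
  omega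

end Favoring

end FLG

/-! ### Total correctness with time bounds for the random access machine -/

namespace RAM

@[simp] theorem State.var_setVar (m : State) (x c y : ℕ) :
    (m.setVar x c).var y = if y = x then c else m.var y := by
  simp [State.setVar, Function.update_apply]

@[simp] theorem State.arr_setVar (m : State) (x c : ℕ) : (m.setVar x c).arr = m.arr := rfl

@[simp] theorem State.var_setArr (m : State) (b i c : ℕ) : (m.setArr b i c).var = m.var := rfl

@[simp] theorem State.arr_setArr (m : State) (b i c d : ℕ) :
    (m.setArr b i c).arr d = if d = b then Function.update (m.arr b) i c else m.arr d := by
  simp only [State.setArr, Function.update_apply]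

/-- Whether `P` contains an assignment to the variable `x`. -/
def Prog.setsVar : Prog → ℕ → Bool
  | .skip, _ => false
  | .assign y _, x => x == y
  | .write _ _ _, _ => false
  | .seq P Q, x => P.setsVar x || Q.setsVar x
  | .ite _ P Q, x => P.setsVar x || Q.setsVar x
  | .loop _ P, x => P.setsVar x

/-- Whether `P` contains a write to the array `b`. -/
def Prog.setsArr : Prog → ℕ → Bool
  | .skip, _ => false
  | .assign _ _, _ => false
  | .write d _ _, b => b == d
  | .seq P Q, b => P.setsArr b || Q.setsArr b
  | .ite _ P Q, b => P.setsArr b || Q.setsArr b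
  | .loop _ P, b => P.setsArr b

/-- The states `m` and `m'` agree outside the variables and arrays that `P` may change. -/
structure Agree (P : Prog) (m m' : State) : Prop where
  var : ∀ x, P.setsVar x = false → m'.var x = m.var x
  arr : ∀ b, P.setsArr b = false → m'.arr b = m.arr b

theorem Agree.refl (P : Prog) (m : State) : Agree P m m := ⟨fun _ _ => rfl, fun _ _ => rfl⟩

theorem Agree.trans {P : Prog} {m₁ m₂ m₃ : State} (h : Agree P m₁ m₂) (h' : Agree P m₂ m₃) :
    Agree P m₁ m₃ :=
  ⟨fun x hx => (h'.var x hx).trans (h.var x hx), fun b hb => (h'.arr b hb).trans (h.arr b hb)⟩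

theorem Agree.mono {P Q : Prog} {m m' : State} (h : Agree P m m')
    (hv : ∀ x, Q.setsVar x = false → P.setsVar x = false)
    (ha : ∀ b, Q.setsArr b = false → P.setsArr b = false) : Agree Q m m' :=
  ⟨fun x hx => h.var x (hv x hx), fun b hb => h.arr b (ha b hb)⟩

theorem Runs.agree {P : Prog} {m m' : State} {t : ℕ} (h : Runs P m t m') : Agree P m m' := by
  induction h with
  | skip => exact Agree.refl _ _
  | assign x e m =>
    refine ⟨fun y hy => ?_, fun _ _ => rfl⟩
    simp only [Prog.setsVar, beq_eq_false_iff_ne] at hy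
    simp [hy]
  | write b i e m =>
    refine ⟨fun _ _ => rfl, fun d hd => ?_⟩
    simp only [Prog.setsArr, beq_eq_false_iff_ne] at hd
    simp [hd]
  | seq _ _ ih ih' =>
    refine (ih.mono ?_ ?_).trans (ih'.mono ?_ ?_) <;>
      simp +contextual [Prog.setsVar, Prog.setsArr]
  | ite_true _ _ ih => refine ih.mono ?_ ?_ <;> simp +contextual [Prog.setsVar, Prog.setsArr]
  | ite_false _ _ ih => refine ih.mono ?_ ?_ <;> simp +contextual [Prog.setsVar, Prog.setsArr]
  | loop_true _ _ _ ih ih' =>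
    refine (ih.mono ?_ ?_).trans ih' <;> simp [Prog.setsVar, Prog.setsArr]
  | loop_false => exact Agree.refl _ _

/-- Started in `m`, the program `P` terminates within `t` steps in a state that satisfies `Q`. -/
def Within (P : Prog) (m : State) (t : ℕ) (Q : State → Prop) : Prop :=
  ∃ t' m', Runs P m t' m' ∧ t' ≤ t ∧ Q m'

theorem Within.mono {P : Prog} {m : State} {t t' : ℕ} {Q Q' : State → Prop}
    (h : Within P m t Q) (ht : t ≤ t') (hQ : ∀ m', Agree P m m' → Q m' → Q' m') :
    Within P m t' Q' := by
  obtain ⟨s, m', hr, hs, hm⟩ := h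
  exact ⟨s, m', hr, hs.trans ht, hQ m' hr.agree hm⟩

theorem Within.seq {P P' : Prog} {m : State} {t₁ t₂ t : ℕ} {Q R : State → Prop}
    (h : Within P m t₁ Q) (h' : ∀ m', Agree P m m' → Q m' → Within P' m' t₂ R)
    (ht : t₁ + t₂ ≤ t) : Within (.seq P P') m t R := by
  obtain ⟨s, m', hr, hs, hm⟩ := h
  obtain ⟨s', m'', hr', hs', hm'⟩ := h' m' hr.agree hm
  exact ⟨_, m'', Runs.seq hr hr', by omega, hm'⟩

theorem Within.ite {e : Expr} {P P' : Prog} {m : State} {t₁ t : ℕ} {R : State → Prop}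
    (h : e.eval m ≠ 0 → Within P m t₁ R) (h' : e.eval m = 0 → Within P' m t₁ R)
    (ht : e.cost + 1 + t₁ ≤ t) : Within (.ite e P P') m t R := by
  by_cases he : e.eval m = 0
  · obtain ⟨s, m', hr, hs, hm⟩ := h' he
    exact ⟨_, m', Runs.ite_false he hr, by omega, hm⟩
  · obtain ⟨s, m', hr, hs, hm⟩ := h he
    exact ⟨_, m', Runs.ite_true he hr, by omega, hm⟩

/-- A loop terminates if its body preserves `Inv` and decreases `μ`. -/
theorem Within.loop {e : Expr} {P : Prog} {m : State} {T B : ℕ} (Inv : State → Prop)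
    (μ : State → ℕ) (h0 : Inv m) (hB : μ m ≤ B)
    (step : ∀ m', Agree (.loop e P) m m' → Inv m' → e.eval m' ≠ 0 →
      Within P m' T fun m'' => Inv m'' ∧ μ m'' < μ m') :
    Within (.loop e P) m (B * (T + e.cost + 1) + e.cost + 1)
      fun m' => Inv m' ∧ e.eval m' = 0 := by
  induction B generalizing m with
  | zero =>
    by_cases he : e.eval m = 0
    · exact ⟨_, m, Runs.loop_false he, by omega, h0, he⟩
    · obtain ⟨_, _, _, _, _, hμ⟩ := step m (Agree.refl _ _) h0 he
      omega
  | succ B ih =>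
    by_cases he : e.eval m = 0
    · exact ⟨_, m, Runs.loop_false he, by omega, h0, he⟩
    · obtain ⟨t₁, m₁, hr, ht₁, hI, hμ⟩ := step m (Agree.refl _ _) h0 he
      have hag : Agree (.loop e P) m m₁ := ⟨hr.agree.var, hr.agree.arr⟩
      obtain ⟨t₂, m₂, hr₂, ht₂, hQ⟩ := ih (m := m₁) hI (by omega)
        fun m' hm' => step m' (hag.trans hm')
      refine ⟨_, m₂, Runs.loop_true he hr hr₂, ?_, hQ⟩
      rw [Nat.succ_mul]
      omega

/-- `for x := 0 to x_y - 1 do P`, where `y` is the index of the variable that holds the bound. -/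
def Prog.forTo (x y : ℕ) (P : Prog) : Prog :=
  .seq (.assign x (.const 0)) (.loop (.sub (.var y) (.var x))
    (.seq P (.assign x (.add (.var x) (.const 1)))))

theorem Within.forTo {x y : ℕ} {P : Prog} {m : State} {T b : ℕ} (Inv : ℕ → State → Prop)
    (hb : m.var y = b) (h0 : Inv 0 (m.setVar x 0))
    (step : ∀ i < b, ∀ m', Agree (.forTo x y P) m m' → m'.var x = i → Inv i m' →
      Within P m' T fun m'' => Inv (i + 1) (m''.setVar x (i + 1)))
    (hx : P.setsVar x = false := by decide) (hy : P.setsVar y = false := by decide)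
    (hxy : y ≠ x := by decide) :
    Within (.forTo x y P) m (b * (T + 8) + 6) (Inv b) := by
  have hloop := Within.loop (e := .sub (.var y) (.var x)) (T := T + 4) (B := b)
    (P := .seq P (.assign x (.add (.var x) (.const 1)))) (m := m.setVar x 0)
    (fun m' => m'.var x ≤ b ∧ m'.var y = b ∧ Inv (m'.var x) m') (fun m' => b - m'.var x)
    (by simp [hxy, hb, h0]) (by simp) ?_
  · refine Within.seq (Q := fun m' => m' = m.setVar x 0) ⟨_, _, Runs.assign _ _ _, le_rfl, rfl⟩
      (fun m' _ hm' => ?_) (t₂ := b * (T + 8) + 4) (by simp [Expr.cost]; omega)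
    subst hm'
    refine hloop.mono (by simp [Expr.cost]) fun m' _ hm' => ?_
    obtain ⟨⟨h1, h2, h3⟩, h4⟩ := hm'
    simp only [Expr.eval] at h4
    have : m'.var x = b := by omega
    rwa [this] at h3
  · rintro m' hag ⟨h1, h2, h3⟩ he
    simp only [Expr.eval] at he
    have hag' : Agree (.forTo x y P) m m' := by
      refine Agree.trans (m₂ := m.setVar x 0) ?_ (hag.mono ?_ ?_)
      · refine ⟨fun z hz => ?_, fun _ _ => rfl⟩
        simp only [Prog.forTo, Prog.setsVar, Bool.or_eq_false_iff, beq_eq_false_iff_ne] at hz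
        simp [hz.1]
      · simp +contextual [Prog.forTo, Prog.setsVar]
      · simp +contextual [Prog.forTo, Prog.setsArr]
    refine Within.seq (step (m'.var x) (by omega) m' hag' rfl h3) (fun m₁ hag₁ hm₁ => ?_)
      (t₂ := 4) le_rfl
    have e1 := hag₁.var x hx
    have e2 := hag₁.var y hy
    refine ⟨_, _, Runs.assign _ _ _, le_rfl, ?_⟩
    simp only [Expr.eval, e1]
    refine ⟨?_, ?_⟩
    · simp only [State.var_setVar, if_true, if_neg hxy]
      exact ⟨by omega, by omega, hm₁⟩
    · simp only [State.var_setVar, if_true]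
      omega

/-- Whether `P` contains no loop. -/
def Prog.loopFree : Prog → Bool
  | .skip => true
  | .assign _ _ => true
  | .write _ _ _ => true
  | .seq P Q => P.loopFree && Q.loopFree
  | .ite _ P Q => P.loopFree && Q.loopFree
  | .loop _ _ => false

/-- The effect of a loop-free program. -/
def Prog.exec : Prog → State → State
  | .skip, m => m
  | .assign x e, m => m.setVar x (e.eval m)
  | .write b i e, m => m.setArr b (i.eval m) (e.eval m)
  | .seq P Q, m => Q.exec (P.exec m)
  | .ite e P Q, m => if e.eval m = 0 then Q.exec m else P.exec m
  | .loop _ _, m => m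

/-- A bound on the number of steps of a loop-free program. -/
def Prog.cost : Prog → ℕ
  | .skip => 1
  | .assign _ e => e.cost + 1
  | .write _ i e => i.cost + e.cost + 1
  | .seq P Q => P.cost + Q.cost
  | .ite e P Q => e.cost + 1 + max P.cost Q.cost
  | .loop _ _ => 0

theorem Prog.runs_exec (P : Prog) (h : P.loopFree = true) (m : State) :
    ∃ t ≤ P.cost, Runs P m t (P.exec m) := by
  induction P generalizing m with
  | skip => exact ⟨_, le_rfl, Runs.skip m⟩
  | assign x e => exact ⟨_, le_rfl, Runs.assign x e m⟩
  | write b i e => exact ⟨_, le_rfl, Runs.write b i e m⟩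
  | seq P Q ihP ihQ =>
    simp only [Prog.loopFree, Bool.and_eq_true] at h
    obtain ⟨t, ht, hr⟩ := ihP h.1 m
    obtain ⟨t', ht', hr'⟩ := ihQ h.2 (P.exec m)
    exact ⟨_, Nat.add_le_add ht ht', Runs.seq hr hr'⟩
  | ite e P Q ihP ihQ =>
    simp only [Prog.loopFree, Bool.and_eq_true] at h
    by_cases he : e.eval m = 0
    · obtain ⟨t, ht, hr⟩ := ihQ h.2 m
      refine ⟨_, ?_, by simpa [Prog.exec, he] using Runs.ite_false he hr⟩
      exact Nat.add_le_add_left (ht.trans (le_max_right _ _)) _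
    · obtain ⟨t, ht, hr⟩ := ihP h.1 m
      refine ⟨_, ?_, by simpa [Prog.exec, he] using Runs.ite_true he hr⟩
      exact Nat.add_le_add_left (ht.trans (le_max_left _ _)) _
  | loop e P => simp [Prog.loopFree] at h

theorem Within.exec {P : Prog} {m : State} {t : ℕ} {Q : State → Prop} (hQ : Q (P.exec m))
    (h : P.loopFree = true := by decide) (ht : P.cost ≤ t := by decide) : Within P m t Q := by
  obtain ⟨s, hs, hr⟩ := P.runs_exec h m
  exact ⟨s, _, hr, hs.trans ht, hQ⟩

end RAM

/-! ### Searching for improving chains of passes -/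

namespace Search

open Relation

/-- The number of clients below `N` that the assignment `A` assigns to `f`. -/
def served (N : ℕ) (A : ℕ → ℕ) (f : ℕ) : ℕ := ((Finset.range N).filter fun u => A u = f).card

/-- Every client below `N` is assigned along the relation `R` to a facility below `K`, or to `K` if
she has no facility in her range. -/
def Valid (R : ℕ → ℕ → Prop) (N K : ℕ) (A : ℕ → ℕ) : Prop :=
  ∀ u < N, (A u < K ∧ R u (A u)) ∨ (A u = K ∧ ∀ h < K, ¬ R u h)

/-- Some client of `f` may patronize `h`. -/
def Pass (R : ℕ → ℕ → Prop) (N K : ℕ) (A : ℕ → ℕ) (f h : ℕ) : Prop :=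
  ∃ u < N, A u = f ∧ h < K ∧ R u h

/-- The facilities with nonzero mark form a tree of passes with root `g`: each marked `f ≠ g` can
pass the client `via f` on to its parent `next f`. The rank `ρ` decreases towards the root. -/
structure Tree (R : ℕ → ℕ → Prop) (N K g : ℕ) (A D next via ρ : ℕ → ℕ) : Prop where
  root : D g ≠ 0
  edge : ∀ f < K, D f ≠ 0 → f ≠ g → next f < K ∧ D (next f) ≠ 0 ∧ via f < N ∧ A (via f) = f ∧
    R (via f) (next f) ∧ ρ (next f) < ρ f
  rank : ∀ f < K, D f ≠ 0 → ρ f < ((Finset.range K).filter fun x => D x ≠ 0).card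

/-- The work that the marks leave to be done: mark `0` is for facilities not yet found, `1` for those
that have been processed, anything else for those that wait to be processed. -/
def work (K : ℕ) (D : ℕ → ℕ) : ℕ :=
  ∑ f ∈ Finset.range K, if D f = 0 then 2 else if D f = 1 then 0 else 1

theorem work_le (K : ℕ) (D : ℕ → ℕ) : work K D ≤ 2 * K := by
  unfold work
  calc _ ≤ ∑ f ∈ Finset.range K, 2 := Finset.sum_le_sum fun f _ => by split_ifs <;> omega
    _ = _ := by simp [mul_comm]

theorem sum_update_lt {K : ℕ} {φ : ℕ → ℕ → ℕ} {D : ℕ → ℕ} {f c : ℕ} (hf : f < K)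
    (h : φ f c < φ f (D f)) :
    ∑ x ∈ Finset.range K, φ x (Function.update D f c x) < ∑ x ∈ Finset.range K, φ x (D x) := by
  refine Finset.sum_lt_sum (fun x _ => ?_) ⟨f, Finset.mem_range.2 hf, by simpa using h⟩
  by_cases hx : x = f
  · subst hx; simpa using h.le
  · rw [Function.update_of_ne hx]

theorem work_update_lt {K : ℕ} {D : ℕ → ℕ} {f c : ℕ} (hf : f < K)
    (h : (D f = 0 ∧ c = 2) ∨ (D f ≠ 0 ∧ D f ≠ 1 ∧ c = 1)) :
    work K (Function.update D f c) < work K D := by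
  unfold work
  refine sum_update_lt (φ := fun _ c => if c = 0 then 2 else if c = 1 then 0 else 1) hf ?_
  rcases h with ⟨h1, rfl⟩ | ⟨h1, h2, rfl⟩
  · simp [h1]
  · simp [h1, h2]

variable {R : ℕ → ℕ → Prop} {N K g : ℕ} {A D next via ρ : ℕ → ℕ}

/-- Only the support of the marks matters. -/
theorem Tree.remark (h : Tree R N K g A D next via ρ) {D' : ℕ → ℕ}
    (hD : ∀ x, D' x = 0 ↔ D x = 0) : Tree R N K g A D' next via ρ := by
  refine ⟨fun h0 => h.root ((hD _).1 h0), fun f hf hf0 hfg => ?_, fun f hf hf0 => ?_⟩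
  · simpa only [ne_eq, hD] using h.edge f hf (fun h0 => hf0 ((hD _).2 h0)) hfg
  · simpa only [ne_eq, hD] using h.rank f hf (fun h0 => hf0 ((hD _).2 h0))

/-- A facility of mark `0` can be added as a leaf. Its rank is the number of facilities marked so far,
which exceeds the rank of each of these. -/
theorem Tree.insert (h : Tree R N K g A D next via ρ) {f p u : ℕ} (hf : f < K) (hf0 : D f = 0)
    (hp : p < K) (hp0 : D p ≠ 0) (hu : u < N) (hA : A u = f) (hR : R u p) :
    Tree R N K g A (Function.update D f 2) (Function.update next f p) (Function.update via f u)
      (Function.update ρ f ((Finset.range K).filter fun x => D x ≠ 0).card) := by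
  have hcard : ((Finset.range K).filter fun x => Function.update D f 2 x ≠ 0).card =
      ((Finset.range K).filter fun x => D x ≠ 0).card + 1 := by
    rw [← Finset.card_insert_of_notMem (a := f) (by simp [hf0])]
    congr 1
    ext x
    by_cases hx : x = f
    · subst hx; simp [hf]
    · simp [hx]
  have hpf : p ≠ f := fun he => hp0 (he ▸ hf0)
  have hgf : g ≠ f := fun he => h.root (he ▸ hf0)
  refine ⟨?_, fun x hx hx0 hxg => ?_, fun x hx hx0 => ?_⟩
  · rw [Function.update_of_ne hgf]; exact h.root
  · by_cases hxf : x = f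
    · subst hxf
      simp only [Function.update_self, Function.update_of_ne hpf]
      exact ⟨hp, hp0, hu, hA, hR, h.rank p hp hp0⟩
    · rw [Function.update_of_ne hxf] at hx0
      obtain ⟨h1, h2, h3, h4, h5, h6⟩ := h.edge x hx hx0 hxg
      have hne : next x ≠ f := fun he => h2 (he ▸ hf0)
      simp only [Function.update_of_ne hxf, Function.update_of_ne hne]
      exact ⟨h1, h2, h3, h4, h5, h6⟩
  · rw [hcard]
    by_cases hxf : x = f
    · subst hxf; simp
    · rw [Function.update_of_ne hxf] at hx0 ⊢
      exact (h.rank x hx hx0).trans (Nat.lt_succ_self _)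

theorem Tree.rank_le (h : Tree R N K g A D next via ρ) {f : ℕ} (hf : f < K) (hf0 : D f ≠ 0) :
    ρ f ≤ K := by
  have h1 := h.rank f hf hf0
  have h2 := Finset.card_filter_le (Finset.range K) fun x => D x ≠ 0
  rw [Finset.card_range] at h2
  omega

/-- Once all marked facilities are processed, the marks cover all facilities that reach the root. -/
theorem marked_of_reach (hroot : D g ≠ 0) (hclosed : ∀ h < K, D h ≠ 0 → ∀ u < N, R u h → D (A u) ≠ 0)
    {f : ℕ} (hr : ReflTransGen (Pass R N K A) f g) : D f ≠ 0 := by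
  induction hr using ReflTransGen.head_induction_on with
  | refl => exact hroot
  | head h1 _ ih =>
    obtain ⟨u, hu, rfl, hh, hR⟩ := h1
    exact hclosed _ hh ih u hu hR

/-! ### Moving a client along a chain of passes -/

/-- Moving client `u` to `h` lowers the load of her old facility and raises that of `h` (the two may
coincide). -/
theorem served_update {u h f : ℕ} (hu : u < N) :
    served N (Function.update A u h) f + (if f = A u then 1 else 0) =
      served N A f + (if f = h then 1 else 0) := by
  have key : ∀ B : ℕ → ℕ, served N B f =
      (((Finset.range N).erase u).filter fun x => B x = f).card + if f = B u then 1 else 0 := by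
    intro B
    rw [served]
    conv_lhs => rw [← Finset.insert_erase (Finset.mem_range.2 hu), Finset.filter_insert]
    by_cases hB : B u = f
    · rw [if_pos hB, Finset.card_insert_of_notMem (by simp), if_pos hB.symm]
    · rw [if_neg hB, if_neg (Ne.symm hB), add_zero]
  rw [key, key A, Function.update_self]
  have : ((Finset.range N).erase u).filter (fun x => Function.update A u h x = f) =
      ((Finset.range N).erase u).filter (fun x => A x = f) := by
    refine Finset.filter_congr fun x hx => ?_
    rw [Function.update_of_ne (Finset.ne_of_mem_erase hx)]
  rw [this]
  omega

/-- The state of a chain of passes from `j` that has arrived at facility `c`: compared to the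
initial assignment `A`, the current assignment `B` serves one client less at `j` and one more at
`c`, and the part of the tree below the rank of `c` is intact. -/
structure Moved (R : ℕ → ℕ → Prop) (N K g : ℕ) (A D via ρ : ℕ → ℕ) (j : ℕ) (B : ℕ → ℕ)
    (c : ℕ) : Prop where
  lt : c < K
  marked : D c ≠ 0
  valid : Valid R N K B
  served : ∀ f, served N B f + (if f = j then 1 else 0) = served N A f + (if f = c then 1 else 0)
  via : ∀ f < K, D f ≠ 0 → f ≠ g → ρ f ≤ ρ c → B (via f) = f

theorem Moved.init (h : Tree R N K g A D next via ρ) (hA : Valid R N K A) {j : ℕ} (hj : j < K)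
    (hj0 : D j ≠ 0) : Moved R N K g A D via ρ j A j :=
  ⟨hj, hj0, hA, fun _ => rfl, fun f hf hf0 hfg _ => (h.edge f hf hf0 hfg).2.2.2.1⟩

/-- The client who is moved away from `c` is not needed further down the tree, where every client to be
passed on is assigned to a facility of smaller rank. -/
theorem Moved.step (h : Tree R N K g A D next via ρ) {j c : ℕ} {B : ℕ → ℕ}
    (hB : Moved R N K g A D via ρ j B c) (hc : c ≠ g) :
    Moved R N K g A D via ρ j (Function.update B (via c) (next c)) (next c) ∧
      ρ (next c) < ρ c := by
  obtain ⟨h1, h2, h3, h4, h5, h6⟩ := h.edge c hB.lt hB.marked hc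
  have hBc := hB.via c hB.lt hB.marked hc le_rfl
  refine ⟨⟨h1, h2, fun u hu => ?_, fun f => ?_, fun f hf hf0 hfg hle => ?_⟩, h6⟩
  · by_cases huc : u = via c
    · subst huc
      rw [Function.update_self]
      exact Or.inl ⟨h1, h5⟩
    · rw [Function.update_of_ne huc]
      exact hB.valid u hu
  · have e1 := served_update (A := B) (h := next c) (f := f) h3
    have e2 := hB.served f
    rw [hBc] at e1
    omega
  · have hne : via f ≠ via c := by
      intro he
      have h7 := hB.via f hf hf0 hfg (by omega)
      rw [he, hBc] at h7
      subst h7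
      omega
    rw [Function.update_of_ne hne]
    exact hB.via f hf hf0 hfg (by omega)

/-- Moving `K` units from a larger to a smaller summand decreases a sum of squares. -/
theorem sum_sq_lt {S : Finset ℕ} {κ κ' : ℕ → ℕ} {j g : ℕ} (hK : 0 < K) (hj : j ∈ S) (hg : g ∈ S)
    (hlt : κ g + K < κ j) (hκ : ∀ f, κ' f + (if f = j then K else 0) = κ f + if f = g then K else 0) :
    ∑ f ∈ S, κ' f ^ 2 < ∑ f ∈ S, κ f ^ 2 := by
  have hjg : j ≠ g := by rintro rfl; omega
  have hg' : g ∈ S.erase j := Finset.mem_erase.2 ⟨hjg.symm, hg⟩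
  rw [← Finset.add_sum_erase S _ hj, ← Finset.add_sum_erase _ _ hg',
    ← Finset.add_sum_erase S (fun f => κ f ^ 2) hj, ← Finset.add_sum_erase _ (fun f => κ f ^ 2) hg']
  have hrest : ∑ f ∈ (S.erase j).erase g, κ' f ^ 2 = ∑ f ∈ (S.erase j).erase g, κ f ^ 2 := by
    refine Finset.sum_congr rfl fun f hf => ?_
    have h1 := Finset.ne_of_mem_erase hf
    have h2 := Finset.ne_of_mem_erase (Finset.mem_of_mem_erase hf)
    have := hκ f
    rw [if_neg h1, if_neg h2] at this
    rw [show κ' f = κ f by omega]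
  have e1 := hκ j
  have e2 := hκ g
  rw [if_pos rfl, if_neg hjg] at e1
  rw [if_pos rfl, if_neg hjg.symm] at e2
  have e3 : κ j = κ' j + K := by omega
  have e4 : κ' g = κ g + K := by omega
  rw [hrest, e3, e4]
  have e5 : κ g < κ' j := by omega
  have := Nat.mul_lt_mul_of_pos_right e5 hK
  nlinarith

end Search

/-! ### The variables and arrays of the program -/

namespace Reg

/-- The length of the input, and finally that of the output. -/
abbrev len : ℕ := 0
/-- The number of clients of the instance. -/
abbrev n : ℕ := 1
/-- The number of facilities. -/
abbrev k : ℕ := 2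
/-- The position of the facility locations in the input. -/
abbrev locs : ℕ := 3
/-- The position of the permutation in the input. -/
abbrev perm : ℕ := 4
/-- The number of clients of the current search. -/
abbrev cnt : ℕ := 5
/-- The start of a row in the edge table. -/
abbrev row : ℕ := 6
/-- The start of a row of the adjacency matrix in the input. -/
abbrev adj : ℕ := 7
/-- A loop variable, mostly for clients. -/
abbrev u : ℕ := 8
/-- A loop variable for facilities. -/
abbrev f : ℕ := 9
/-- A loop variable for facilities. -/
abbrev h : ℕ := 10
/-- The facility that the current search aims at. -/
abbrev g : ℕ := 11
/-- The start of an improving chain of passes, if there is one. -/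
abbrev start : ℕ := 12
/-- The current facility of a chain of passes. -/
abbrev cur : ℕ := 13
/-- The number of copies per client. -/
abbrev copies : ℕ := 14
/-- Four times the number of facilities. -/
abbrev quad : ℕ := 15

end Reg

namespace Mem

/-- The input, and finally the output. -/
abbrev io : ℕ := 0
/-- For each client the start of her row in the edge tables. -/
abbrev base : ℕ := 1
/-- The edges of the instance. -/
abbrev edge : ℕ := 2
/-- The edges that the search may use. -/
abbrev live : ℕ := 3
/-- For each client her facility. -/
abbrev asg : ℕ := 4
/-- For each facility `k` times its load plus its position in the permutation. -/
abbrev key : ℕ := 5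
/-- Marks of the facilities: `0` if not found, `2` if found, `1` if also processed. -/
abbrev mark : ℕ := 6
/-- For each marked facility the next one on the chain of passes to `Reg.g`. -/
abbrev next : ℕ := 7
/-- For each marked facility the client to be passed on. -/
abbrev via : ℕ := 8

end Mem

/-! ### The search program -/

namespace Search

open RAM RAM.Expr RAM.Prog Relation

/-- Whether client `Reg.u` may patronize facility `Reg.h`. -/
def liveUH : Expr := read Mem.live (add (read Mem.base (var Reg.u)) (var Reg.h))

/-- The facility of client `Reg.u`. -/
def asgU : Expr := read Mem.asg (var Reg.u)

/-- Start each key as the position of the facility in the permutation. -/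
def initKeys : Prog :=
  forTo Reg.u Reg.k (write Mem.key (read Mem.io (add (var Reg.perm) (var Reg.u))) (var Reg.u))

/-- Assign client `Reg.u` along some edge, or to the dummy facility `k` if she has none. -/
def assignClient : Prog :=
  seq (write Mem.asg (var Reg.u) (var Reg.k))
    (forTo Reg.h Reg.k (ite liveUH (write Mem.asg (var Reg.u) (var Reg.h)) skip))

/-- Count client `Reg.u` in the key of her facility. For the dummy facility this changes a cell that is
never read otherwise. -/
def countClient : Prog := write Mem.key asgU (add (read Mem.key asgU) (var Reg.k))

def assignAll : Prog := forTo Reg.u Reg.cnt (seq assignClient countClient)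

/-- Mark the facility of client `Reg.u` as found if this client can be passed on to `Reg.h`. -/
def visit : Prog :=
  ite liveUH (ite (read Mem.mark asgU) skip
    (seq (write Mem.next asgU (var Reg.h))
      (seq (write Mem.via asgU (var Reg.u)) (write Mem.mark asgU (const 2))))) skip

/-- Find all facilities that can pass a client on to `Reg.h`, and resume the scan for facilities that
wait to be processed at `0`. -/
def process : Prog :=
  seq (seq (write Mem.mark (var Reg.h) (const 1)) (forTo Reg.u Reg.cnt visit))
    (assign Reg.h (const 0))

def clearMarks : Prog := forTo Reg.f Reg.k (write Mem.mark (var Reg.f) (const 0))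

def exploreBody : Prog :=
  ite (sub (read Mem.mark (var Reg.h)) (const 1)) process
    (assign Reg.h (add (var Reg.h) (const 1)))

/-- Mark the facilities that can reach `Reg.g` by a chain of passes. -/
def explore : Prog :=
  seq (seq clearMarks (seq (write Mem.mark (var Reg.g) (const 2)) (assign Reg.h (const 0))))
    (loop (sub (var Reg.k) (var Reg.h)) exploreBody)

/-- Look for a marked facility from which a chain of passes to `Reg.g` is an improvement; the result
is `k` if there is none. -/
def findStart : Prog :=
  seq (assign Reg.start (var Reg.k))
    (forTo Reg.f Reg.k (ite (read Mem.mark (var Reg.f))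
      (ite (sub (read Mem.key (var Reg.f)) (add (read Mem.key (var Reg.g)) (var Reg.k)))
        (assign Reg.start (var Reg.f)) skip) skip))

def followBody : Prog :=
  seq (assign Reg.u (read Mem.via (var Reg.cur)))
    (seq (assign Reg.cur (read Mem.next (var Reg.cur)))
      (write Mem.asg (var Reg.u) (var Reg.cur)))

/-- Pass one client on at each step of the chain from `Reg.start` to `Reg.g`. -/
def follow : Prog :=
  seq (assign Reg.cur (var Reg.start))
    (loop (add (sub (var Reg.cur) (var Reg.g)) (sub (var Reg.g) (var Reg.cur))) followBody)

/-- Record the move of one unit of load from `Reg.start` to `Reg.g`, and consider all targets again. -/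
def updateKeys : Prog :=
  seq (write Mem.key (var Reg.start) (sub (read Mem.key (var Reg.start)) (var Reg.k)))
    (seq (write Mem.key (var Reg.g) (add (read Mem.key (var Reg.g)) (var Reg.k)))
      (assign Reg.g (const 0)))

/-- Apply an improving chain of passes to `Reg.g`, or go to the next target if there is none. -/
def searchBody : Prog :=
  seq explore (seq findStart (ite (sub (var Reg.k) (var Reg.start)) (seq follow updateKeys)
    (assign Reg.g (add (var Reg.g) (const 1)))))

def improve : Prog :=
  seq (assign Reg.g (const 0)) (loop (sub (var Reg.k) (var Reg.g)) searchBody)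

/-- The search assigns the clients arbitrarily along the edges and then applies improving chains of
passes until there are none. -/
def search : Prog := seq (seq initKeys assignAll) improve

/-- The parameters of a search, as found in the memory. -/
structure Ctx (R : ℕ → ℕ → Prop) (N K : ℕ) (m : State) : Prop where
  k : m.var Reg.k = K
  cnt : m.var Reg.cnt = N
  live : ∀ u h, m.arr Mem.live (m.arr Mem.base u + h) ≠ 0 ↔ R u h

theorem Ctx.agree {R : ℕ → ℕ → Prop} {N K : ℕ} {m m' : State} (h : Ctx R N K m) {P : Prog}
    (ha : Agree P m m') (h1 : P.setsVar Reg.k = false := by decide)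
    (h2 : P.setsVar Reg.cnt = false := by decide) (h3 : P.setsArr Mem.live = false := by decide)
    (h4 : P.setsArr Mem.base = false := by decide) : Ctx R N K m' := by
  refine ⟨(ha.var _ h1).trans h.k, (ha.var _ h2).trans h.cnt, fun u x => ?_⟩
  rw [ha.arr _ h3, ha.arr _ h4]
  exact h.live u x

variable {R : ℕ → ℕ → Prop} {N K : ℕ} {m : State} {pos : ℕ → ℕ}

theorem initKeys_spec (hk : m.var Reg.k = K)
    (hpos : ∀ i < K, pos (m.arr Mem.io (m.var Reg.perm + i)) = i)
    (hsurj : ∀ f < K, ∃ i < K, m.arr Mem.io (m.var Reg.perm + i) = f) :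
    Within initKeys m (K * 14 + 6) fun m' => ∀ f < K, m'.arr Mem.key f = pos f := by
  refine (Within.forTo (T := 6) (fun i m' => ∀ j < i, m'.arr Mem.key
    (m.arr Mem.io (m.var Reg.perm + j)) = j) hk (by simp) ?_).mono le_rfl ?_
  · intro i hi m' hag hx hInv
    refine Within.exec ?_
    have e1 : m'.arr Mem.io = m.arr Mem.io := hag.arr _ (by decide)
    have e2 : m'.var Reg.perm = m.var Reg.perm := hag.var _ (by decide)
    intro j hj
    simp only [Prog.exec, Expr.eval, State.arr_setVar, State.arr_setArr, if_true, e1, e2, hx,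
      Function.update_apply]
    split_ifs with h
    · rw [← hpos j (by omega), h, hpos i hi]
    · refine hInv j ?_
      rcases Nat.lt_succ_iff_lt_or_eq.1 hj with h' | rfl
      · exact h'
      · exact absurd rfl h
  · intro m' _ hInv f hf
    obtain ⟨i, hi, rfl⟩ := hsurj f hf
    rw [hInv i hi, hpos i hi]

theorem assignClient_spec (hm : Ctx R N K m) :
    Within assignClient m (K * 20 + 10) fun m' =>
      (∀ u, u ≠ m.var Reg.u → m'.arr Mem.asg u = m.arr Mem.asg u) ∧
      ((m'.arr Mem.asg (m.var Reg.u) < K ∧ R (m.var Reg.u) (m'.arr Mem.asg (m.var Reg.u))) ∨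
        (m'.arr Mem.asg (m.var Reg.u) = K ∧ ∀ h < K, ¬ R (m.var Reg.u) h)) := by
  refine Within.seq (t₁ := 3) (t₂ := K * 20 + 6) (Q := fun m' =>
    m' = m.setArr Mem.asg (m.var Reg.u) K) (Within.exec ?_) ?_ (by omega)
  · simp [Prog.exec, Expr.eval, hm.k]
  · rintro m₁ hag rfl
    have hm₁ := hm.agree hag
    refine Within.forTo (T := 12) (fun i m' => (∀ u, u ≠ m.var Reg.u → m'.arr Mem.asg u =
      m.arr Mem.asg u) ∧ ((m'.arr Mem.asg (m.var Reg.u) < K ∧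
      R (m.var Reg.u) (m'.arr Mem.asg (m.var Reg.u))) ∨
        (m'.arr Mem.asg (m.var Reg.u) = K ∧ ∀ h < i, ¬ R (m.var Reg.u) h))) hm₁.k ?_ ?_
    · refine ⟨fun u hu => ?_, Or.inr ⟨?_, by simp⟩⟩
      · simp [Function.update_of_ne hu]
      · simp
    · intro i hi m' hag' hx hInv
      have hm' := hm₁.agree hag'
      have e1 : m'.var Reg.u = m.var Reg.u := hag'.var _ (by decide)
      have hl := hm'.live (m.var Reg.u) i
      refine Within.exec ?_
      simp only [Prog.exec, liveUH, Expr.eval, e1, hx]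
      split_ifs with h
      · rw [h] at hl
        refine ⟨fun u hu => by simpa using hInv.1 u hu, ?_⟩
        simp only [State.arr_setVar]
        refine hInv.2.imp id fun h' => ⟨h'.1, fun x hx => ?_⟩
        rcases Nat.lt_succ_iff_lt_or_eq.1 hx with h'' | rfl
        · exact h'.2 x h''
        · exact fun hR => hl.2 hR rfl
      · refine ⟨fun u hu => ?_, Or.inl ?_⟩
        · simpa [Function.update_of_ne hu] using hInv.1 u hu
        · simpa using ⟨hi, hl.1 h⟩

theorem assignAll_spec (hm : Ctx R N K m) (hkey : ∀ f < K, m.arr Mem.key f = pos f) :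
    Within assignAll m (N * (K * 20 + 30) + 6) fun m' =>
      Valid R N K (m'.arr Mem.asg) ∧
      ∀ f < K, m'.arr Mem.key f = K * served N (m'.arr Mem.asg) f + pos f := by
  refine (Within.forTo (T := K * 20 + 20) (fun i m' => Valid R i K (m'.arr Mem.asg) ∧
      ∀ f < K, m'.arr Mem.key f = K * served i (m'.arr Mem.asg) f + pos f) hm.cnt ?_ ?_).mono
        (by ring_nf; omega) fun _ _ h => h
  · refine ⟨fun u hu => absurd hu (Nat.not_lt_zero _), fun f hf => ?_⟩
    change m.arr Mem.key f = K * 0 + pos f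
    rw [hkey f hf, mul_zero, zero_add]
  · intro i hi m' hag hx hInv
    have hm' := hm.agree hag
    refine Within.seq (assignClient_spec hm') (fun m₁ hag₁ h₁ => Within.exec (t := 10) ?_) (by omega)
    rw [hx] at h₁
    obtain ⟨h₁, h₂⟩ := h₁
    have hm₁ := hm'.agree hag₁
    have e1 : m₁.var Reg.u = i := (hag₁.var _ (by decide)).trans hx
    have e2 : m₁.arr Mem.key = m'.arr Mem.key := hag₁.arr _ (by decide)
    have hA : (countClient.exec m₁).arr Mem.asg = m₁.arr Mem.asg := by
      simp [countClient, Prog.exec]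
    simp only [State.arr_setVar, hA]
    refine ⟨fun u hu => ?_, fun f hf => ?_⟩
    · rcases Nat.lt_succ_iff_lt_or_eq.1 hu with hu | rfl
      · rw [h₁ u hu.ne]; exact hInv.1 u hu
      · exact h₂
    · have h3 : served (i + 1) (m₁.arr Mem.asg) f = served i (m'.arr Mem.asg) f +
          if m₁.arr Mem.asg i = f then 1 else 0 := by
        unfold served
        have : (Finset.range i).filter (fun u => m₁.arr Mem.asg u = f) =
            (Finset.range i).filter (fun u => m'.arr Mem.asg u = f) :=
          Finset.filter_congr fun u hu => by rw [h₁ u (Finset.mem_range.1 hu).ne]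
        rw [Finset.range_add_one, Finset.filter_insert, this]
        split_ifs
        · rw [Finset.card_insert_of_notMem (by simp)]
        · rfl
      have h4 := hInv.2 f hf
      rw [h3]
      simp only [countClient, asgU, Prog.exec, Expr.eval, State.arr_setArr, if_true, e1, e2, hm₁.k,
        Function.update_apply]
      by_cases hf' : f = m₁.arr Mem.asg i
      · rw [if_pos hf', if_pos hf'.symm, ← hf', h4]; ring
      · rw [if_neg hf', if_neg (Ne.symm hf'), h4]; ring

theorem clearMarks_spec (hk : m.var Reg.k = K) :
    Within clearMarks m (K * 12 + 6) fun m' => ∀ f < K, m'.arr Mem.mark f = 0 := by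
  refine (Within.forTo (T := 4) (fun i m' => ∀ f < i, m'.arr Mem.mark f = 0) hk (by simp)
    ?_).mono le_rfl fun _ _ h => h
  intro i hi m' hag hx hInv
  refine Within.exec ?_
  intro f hf
  simp only [Prog.exec, Expr.eval, State.arr_setVar, State.arr_setArr, if_true, hx,
    Function.update_apply]
  split_ifs with h
  · rfl
  · exact hInv f (by omega)

end Search

/-! ### Correctness and running time of the search -/

namespace Search

open RAM RAM.Expr RAM.Prog Relation

variable {R : ℕ → ℕ → Prop} {N K : ℕ} {m : State} {pos : ℕ → ℕ}

/-- The marks form a tree with root `g`, and every client who may patronize a processed facility is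
assigned to a marked one. -/
def Explored (R : ℕ → ℕ → Prop) (N K g : ℕ) (m : State) : Prop :=
  (∃ ρ, Tree R N K g (m.arr Mem.asg) (m.arr Mem.mark) (m.arr Mem.next) (m.arr Mem.via) ρ) ∧
    ∀ h < K, m.arr Mem.mark h = 1 → ∀ u < N, R u h → m.arr Mem.mark (m.arr Mem.asg u) ≠ 0

/-- Processing a facility decreases the work, since finding a facility does too. -/
theorem process_spec (hm : Ctx R N K m) {g : ℕ} (hA : Valid R N K (m.arr Mem.asg))
    (hE : Explored R N K g m) (hh : m.var Reg.h < K) (h0 : m.arr Mem.mark (m.var Reg.h) ≠ 0)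
    (h1 : m.arr Mem.mark (m.var Reg.h) ≠ 1) :
    Within process m (N * 40 + 20) fun m' => Explored R N K g m' ∧ m'.var Reg.h = 0 ∧
      work K (m'.arr Mem.mark) < work K (m.arr Mem.mark) := by
  obtain ⟨p, hp⟩ : ∃ p, p = m.var Reg.h := ⟨_, rfl⟩
  rw [← hp] at hh h0 h1
  have hA' : ∀ m', Agree process m m' → m'.arr Mem.asg = m.arr Mem.asg := fun m' h =>
    h.arr _ (by decide)
  refine Within.seq (t₁ := N * 40 + 14) (t₂ := 2) (Q := fun m' => Explored R N K g m' ∧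
      work K (m'.arr Mem.mark) < work K (m.arr Mem.mark)) ?_
    (fun m' _ hQ => Within.exec ?_) (by omega)
  swap
  · simpa [Prog.exec, Expr.eval, Explored] using hQ
  refine Within.seq (t₁ := 3) (t₂ := N * 40 + 6)
    (Q := fun m' => m' = m.setArr Mem.mark p 1) (Within.exec ?_) ?_ (by omega)
  · simp [Prog.exec, Expr.eval, hp]
  rintro m₁ hag₁ rfl
  have hm₁ := hm.agree hag₁
  -- Facility `p` already bears mark `1`, but only the clients below `i` have been looked at.
  refine (Within.forTo (T := 32) (fun i m' =>
    (∃ ρ, Tree R N K g (m.arr Mem.asg) (m'.arr Mem.mark) (m'.arr Mem.next) (m'.arr Mem.via) ρ) ∧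
    (∀ h < K, m'.arr Mem.mark h = 1 → ∀ u, (if h = p then u < i else u < N) → R u h →
      m'.arr Mem.mark (m.arr Mem.asg u) ≠ 0) ∧ m'.arr Mem.mark p = 1 ∧
      work K (m'.arr Mem.mark) < work K (m.arr Mem.mark)) hm₁.cnt ?_ ?_).mono le_rfl ?_
  · obtain ⟨⟨ρ, hT⟩, hcl⟩ := hE
    simp only [State.arr_setVar, State.arr_setArr, if_true]
    have hiff : ∀ x, Function.update (m.arr Mem.mark) p 1 x = 0 ↔ m.arr Mem.mark x = 0 := by
      intro x
      by_cases hx : x = p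
      · subst hx; simp [h0]
      · rw [Function.update_of_ne hx]
    refine ⟨⟨ρ, hT.remark hiff⟩, fun h hh' hmark u hu hR => ?_, by simp,
      work_update_lt hh (Or.inr ⟨h0, h1, rfl⟩)⟩
    by_cases hx : h = p
    · rw [if_pos hx] at hu; omega
    · rw [if_neg hx] at hu
      rw [Function.update_of_ne hx] at hmark
      rw [ne_eq, hiff]
      exact hcl h hh' hmark u hu hR
  · intro i hi m' hag hx hInv
    have hm' := hm₁.agree hag
    have eA : m'.arr Mem.asg = m.arr Mem.asg := hag.arr _ (by decide)
    have eh : m'.var Reg.h = p := (hag.var _ (by decide)).trans hp.symm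
    have hl := hm'.live i p
    obtain ⟨⟨ρ, hT⟩, hcl, hp1, hw⟩ := hInv
    refine Within.exec ?_
    simp only [Prog.exec, liveUH, asgU, Expr.eval, hx, eh, eA, visit]
    by_cases hR : R i p
    swap
    · rw [if_pos (by by_contra hne; exact hR (hl.1 hne))]
      refine ⟨⟨ρ, hT⟩, fun h hh' hmark u hu hRu => ?_, hp1, hw⟩
      refine hcl h hh' hmark u ?_ hRu
      split_ifs at hu ⊢ with hhp
      · subst hhp
        rcases Nat.lt_succ_iff_lt_or_eq.1 hu with hu | rfl
        · exact hu
        · exact absurd hRu hR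
      · exact hu
    rw [if_neg (hl.2 hR)]
    by_cases hD : m'.arr Mem.mark (m.arr Mem.asg i) = 0
    swap
    · rw [if_neg hD]
      refine ⟨⟨ρ, hT⟩, fun h hh' hmark u hu hRu => ?_, hp1, hw⟩
      simp only [State.arr_setVar] at hmark ⊢
      by_cases hui : u = i
      · rw [hui]; exact hD
      · refine hcl h hh' hmark u ?_ hRu
        split_ifs at hu ⊢ with hhp
        · omega
        · exact hu
    rw [if_pos hD]
    have hlt : m.arr Mem.asg i < K := by
      rcases hA i hi with h | h
      · exact h.1
      · exact absurd hR (h.2 p hh)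
    have hpf : p ≠ m.arr Mem.asg i := fun he => by rw [← he, hp1] at hD; omega
    simp [eA, hx]
    refine ⟨⟨_, hT.insert hlt hD hh (by rw [hp1]; exact one_ne_zero) hi rfl hR⟩,
      fun h hh' hmark u hu hRu => ?_, ?_, ?_⟩
    · by_cases hA' : m.arr Mem.asg u = m.arr Mem.asg i
      · rw [hA']; simp
      · rw [Function.update_of_ne hA']
        by_cases hhf : h = m.arr Mem.asg i
        · rw [hhf] at hmark; simp at hmark
        · rw [Function.update_of_ne hhf] at hmark
          refine hcl h hh' hmark u ?_ hRu
          split_ifs at hu ⊢ with hhp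
          · have : u ≠ i := fun he => hA' (by rw [he])
            omega
          · exact hu
    · rw [Function.update_of_ne hpf, hp1]
    · exact (work_update_lt hlt (Or.inl ⟨hD, rfl⟩)).trans hw
  · intro m' hag hInv
    have eA : m'.arr Mem.asg = m.arr Mem.asg := hag.arr _ (by decide)
    obtain ⟨hT, hcl, hp1, hw⟩ := hInv
    refine ⟨⟨by rwa [eA], fun h hh' hmark u hu hR => ?_⟩, hw⟩
    rw [eA]
    exact hcl h hh' hmark u (by split_ifs <;> exact hu) hR

theorem explore_spec (hm : Ctx R N K m) (hg : m.var Reg.g < K)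
    (hA : Valid R N K (m.arr Mem.asg)) :
    Within explore m (((2 * K + 1) * (K + 1)) * (N * 40 + 40) + K * 12 + 20) fun m' =>
      (∃ ρ, Tree R N K (m.var Reg.g) (m.arr Mem.asg) (m'.arr Mem.mark) (m'.arr Mem.next)
        (m'.arr Mem.via) ρ) ∧
      ∀ h < K, m'.arr Mem.mark h ≠ 0 → ∀ u < N, R u h → m'.arr Mem.mark (m.arr Mem.asg u) ≠ 0 := by
  refine Within.seq (t₁ := K * 12 + 11) (t₂ := ((2 * K + 1) * (K + 1)) * (N * 40 + 40) + 4)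
    (Q := fun m' => Explored R N K (m.var Reg.g) m' ∧ m'.var Reg.h = 0) ?_ ?_ (by omega)
  · refine Within.seq (clearMarks_spec hm.k) (fun m₁ hag h₁ => Within.exec (t := 5) ?_) (by omega)
    have e1 : m₁.var Reg.g = m.var Reg.g := hag.var _ (by decide)
    have e2 : m₁.arr Mem.asg = m.arr Mem.asg := hag.arr _ (by decide)
    simp [Prog.exec, Expr.eval, Explored, e1, e2]
    have hz : ∀ x, x < K → ∀ c, Function.update (m₁.arr Mem.mark) (m.var Reg.g) c x =
        Function.update (fun _ => 0) (m.var Reg.g) c x := by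
      intro x hx c
      by_cases hxg : x = m.var Reg.g
      · subst hxg; simp
      · simp [Function.update_of_ne hxg, h₁ x hx]
    refine ⟨⟨fun _ => 0, by simp, fun f hf hf0 hfg => ?_, fun f hf hf0 => ?_⟩, ?_⟩
    · rw [hz f hf] at hf0
      simp [hfg] at hf0
    · exact Finset.card_pos.2 ⟨f, Finset.mem_filter.2 ⟨Finset.mem_range.2 hf, hf0⟩⟩
    · intro h hh hmark
      rw [hz h hh] at hmark
      by_cases hxg : h = m.var Reg.g
      · subst hxg; simp at hmark
      · simp [Function.update_of_ne hxg] at hmark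
  · rintro m₁ hag₁ ⟨hE₁, hh₁⟩
    have hm₁ := hm.agree hag₁
    have e1 : m₁.arr Mem.asg = m.arr Mem.asg := hag₁.arr _ (by decide)
    -- The scan `h` is reset whenever the work decreases, so the two are combined lexicographically.
    refine (Within.loop (T := N * 40 + 26) (B := (2 * K + 1) * (K + 1))
      (fun m' => Explored R N K (m.var Reg.g) m' ∧
        ∀ f < m'.var Reg.h, f < K → m'.arr Mem.mark f = 0 ∨ m'.arr Mem.mark f = 1)
      (fun m' => work K (m'.arr Mem.mark) * (K + 1) + (K - m'.var Reg.h))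
      ⟨hE₁, fun f hf => by omega⟩ ?_ ?_).mono ?_ ?_
    · have := Nat.mul_le_mul_right (K + 1) (work_le K (m₁.arr Mem.mark))
      rw [Nat.add_mul]
      omega
    · intro m' hag hInv he
      have hm' := hm₁.agree hag
      simp only [Expr.eval, hm'.k] at he
      have eA : m'.arr Mem.asg = m.arr Mem.asg := (hag.arr _ (by decide)).trans e1
      refine Within.ite (t₁ := N * 40 + 20) (fun hne => ?_) (fun heq => ?_)
        (by simp [Expr.cost]; omega)
      · simp only [Expr.eval] at hne
        refine (process_spec hm' (eA ▸ hA) hInv.1 (by omega) (by omega) (by omega)).mono le_rfl ?_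
        rintro m'' _ ⟨h1, h2, h3⟩
        refine ⟨⟨h1, fun f hf => by omega⟩, ?_⟩
        have := Nat.mul_le_mul_right (K + 1) h3
        rw [Nat.succ_mul] at this
        omega
      · simp only [Expr.eval] at heq
        refine Within.exec ?_ (by decide) (le_trans (by decide) (Nat.le_add_left 20 _))
        refine ⟨⟨by simpa [Prog.exec, Explored] using hInv.1, fun f hf hfK => ?_⟩, ?_⟩
        · simp only [Prog.exec, Expr.eval, State.var_setVar, if_true, State.arr_setVar] at hf ⊢
          rcases Nat.lt_succ_iff_lt_or_eq.1 hf with hf | rfl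
          · exact hInv.2 f hf hfK
          · omega
        · simp only [Prog.exec, Expr.eval, State.var_setVar, if_true, State.arr_setVar]
          omega
    · simp only [Expr.cost]
      have : N * 40 + 26 + (1 + 1 + 1) + 1 ≤ N * 40 + 40 := by omega
      have := Nat.mul_le_mul_left ((2 * K + 1) * (K + 1)) this
      omega
    · rintro m' hag ⟨⟨⟨hT, hcl⟩, hdone⟩, he⟩
      have hm' := hm₁.agree hag
      have eA : m'.arr Mem.asg = m.arr Mem.asg := (hag.arr _ (by decide)).trans e1
      simp only [Expr.eval, hm'.k] at he
      rw [eA] at hT hcl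
      refine ⟨hT, fun h hh hne => hcl h hh ?_⟩
      rcases hdone h (by omega) hh with h' | h'
      · exact absurd h' hne
      · exact h'

theorem findStart_spec (hm : Ctx R N K m) :
    Within findStart m (K * 22 + 8) fun m' =>
      (m'.var Reg.start = K ∧ ∀ f < K, m.arr Mem.mark f ≠ 0 →
        m.arr Mem.key f ≤ m.arr Mem.key (m.var Reg.g) + K) ∨
      (m'.var Reg.start < K ∧ m.arr Mem.mark (m'.var Reg.start) ≠ 0 ∧
        m.arr Mem.key (m.var Reg.g) + K < m.arr Mem.key (m'.var Reg.start)) := by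
  refine Within.seq (t₁ := 2) (t₂ := K * 22 + 6) (Q := fun m' => m' = m.setVar Reg.start K)
    (Within.exec (by simp [Prog.exec, Expr.eval, hm.k])) ?_ (by omega)
  rintro m₁ hag₁ rfl
  have hm₁ := hm.agree hag₁
  refine Within.forTo (T := 14) (fun i m' =>
      (m'.var Reg.start = K ∧ ∀ f < i, m.arr Mem.mark f ≠ 0 →
        m.arr Mem.key f ≤ m.arr Mem.key (m.var Reg.g) + K) ∨
      (m'.var Reg.start < K ∧ m.arr Mem.mark (m'.var Reg.start) ≠ 0 ∧
        m.arr Mem.key (m.var Reg.g) + K < m.arr Mem.key (m'.var Reg.start))) hm₁.k ?_ ?_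
  · left; simp
  · intro i hi m' hag hx hInv
    have hm' := hm₁.agree hag
    have e1 : m'.arr Mem.mark = m.arr Mem.mark := hag.arr _ (by decide)
    have e2 : m'.arr Mem.key = m.arr Mem.key := hag.arr _ (by decide)
    have e3 : m'.var Reg.g = m.var Reg.g := hag.var _ (by decide)
    have hstep : (m.arr Mem.mark i ≠ 0 → m.arr Mem.key i ≤ m.arr Mem.key (m.var Reg.g) + K) →
        (m'.var Reg.start = K ∧ ∀ f < i + 1, m.arr Mem.mark f ≠ 0 →
          m.arr Mem.key f ≤ m.arr Mem.key (m.var Reg.g) + K) ∨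
        (m'.var Reg.start < K ∧ m.arr Mem.mark (m'.var Reg.start) ≠ 0 ∧
          m.arr Mem.key (m.var Reg.g) + K < m.arr Mem.key (m'.var Reg.start)) := by
      intro hle
      refine hInv.imp (fun h => ⟨h.1, fun f hf => ?_⟩) id
      rcases Nat.lt_succ_iff_lt_or_eq.1 hf with hf | rfl
      · exact h.2 f hf
      · exact hle
    refine Within.exec ?_
    simp only [Prog.exec, Expr.eval, hx, e1, e2, e3, hm'.k]
    split_ifs with h1 h2
    · simpa using hstep fun h => absurd h1 h
    · simpa using hstep fun _ => by omega
    · right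
      simpa using ⟨hi, h1, by omega⟩

theorem follow_spec {g j : ℕ} {ρ : ℕ → ℕ} (hg : m.var Reg.g = g)
    (hj : m.var Reg.start = j) (hjK : j < K) (hj0 : m.arr Mem.mark j ≠ 0)
    (hA : Valid R N K (m.arr Mem.asg))
    (hT : Tree R N K g (m.arr Mem.asg) (m.arr Mem.mark) (m.arr Mem.next) (m.arr Mem.via) ρ) :
    Within follow m (K * 20 + 20) fun m' => Valid R N K (m'.arr Mem.asg) ∧
      ∀ f, served N (m'.arr Mem.asg) f + (if f = j then 1 else 0) =
        served N (m.arr Mem.asg) f + (if f = g then 1 else 0) := by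
  refine Within.seq (t₁ := 2) (t₂ := K * 20 + 18) (Q := fun m' => m' = m.setVar Reg.cur j)
    (Within.exec (by simp [Prog.exec, Expr.eval, hj])) ?_ (by omega)
  rintro m₁ hag₁ rfl
  refine (Within.loop (T := 12) (B := K)
    (fun m' => Moved R N K g (m.arr Mem.asg) (m.arr Mem.mark) (m.arr Mem.via) ρ j
      (m'.arr Mem.asg) (m'.var Reg.cur)) (fun m' => ρ (m'.var Reg.cur)) ?_ ?_ ?_).mono
      (by simp only [Expr.cost]; omega) ?_
  · simpa using Moved.init hT hA hjK hj0
  · simpa using hT.rank_le hjK hj0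
  · intro m' hag hInv he
    have e1 : m'.arr Mem.next = m.arr Mem.next := hag.arr _ (by decide)
    have e2 : m'.arr Mem.via = m.arr Mem.via := hag.arr _ (by decide)
    have e3 : m'.var Reg.g = g := (hag.var _ (by decide)).trans (by simpa using hg)
    simp only [Expr.eval, e3] at he
    refine Within.exec ?_
    simpa [Prog.exec, followBody, Expr.eval, e1, e2] using Moved.step hT hInv (by omega)
  · rintro m' hag ⟨hInv, he⟩
    have e3 : m'.var Reg.g = g := (hag.var _ (by decide)).trans (by simpa using hg)
    simp only [Expr.eval, e3] at he
    have hcg : m'.var Reg.cur = g := by omega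
    rw [hcg] at hInv
    exact ⟨hInv.valid, hInv.served⟩

/-- The invariant of the search: the keys are up to date and no chain of passes to a facility below
`g` is an improvement. -/
structure Good (R : ℕ → ℕ → Prop) (N K : ℕ) (pos A key : ℕ → ℕ) (g : ℕ) : Prop where
  valid : Valid R N K A
  keys : ∀ f < K, key f = K * served N A f + pos f
  stable : ∀ f < K, ∀ h < K, h < g → ReflTransGen (Pass R N K A) f h → key f ≤ key h + K

/-- Either a chain of passes is applied, which decreases the sum of the squared keys, or the target
`g` advances. -/
theorem searchBody_spec (hm : Ctx R N K m) {g : ℕ} (hg : m.var Reg.g = g) (hgK : g < K)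
    (hgood : Good R N K pos (m.arr Mem.asg) (m.arr Mem.key) g) :
    Within searchBody m (((2 * K + 1) * (K + 1)) * (N * 40 + 40) + K * 54 + 80) fun m' =>
      Good R N K pos (m'.arr Mem.asg) (m'.arr Mem.key) (m'.var Reg.g) ∧
      (∑ f ∈ Finset.range K, m'.arr Mem.key f ^ 2) * (K + 1) + (K - m'.var Reg.g) <
        (∑ f ∈ Finset.range K, m.arr Mem.key f ^ 2) * (K + 1) + (K - g) := by
  refine Within.seq (t₂ := K * 42 + 60) (explore_spec hm (hg ▸ hgK) hgood.valid) ?_ (by omega)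
  rintro m₁ hag₁ ⟨⟨ρ, hT⟩, hcl⟩
  have hm₁ := hm.agree hag₁
  rw [hg] at hT
  have a₁ : m₁.arr Mem.asg = m.arr Mem.asg := hag₁.arr _ (by decide)
  have k₁ : m₁.arr Mem.key = m.arr Mem.key := hag₁.arr _ (by decide)
  have g₁ : m₁.var Reg.g = g := (hag₁.var _ (by decide)).trans hg
  refine Within.seq (t₂ := K * 20 + 52) (findStart_spec hm₁) ?_ (by omega)
  intro m₂ hag₂ hstart
  have hm₂ := hm₁.agree hag₂
  have a₂ : m₂.arr Mem.asg = m.arr Mem.asg := (hag₂.arr _ (by decide)).trans a₁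
  have k₂ : m₂.arr Mem.key = m.arr Mem.key := (hag₂.arr _ (by decide)).trans k₁
  have g₂ : m₂.var Reg.g = g := (hag₂.var _ (by decide)).trans g₁
  have d₂ : m₂.arr Mem.mark = m₁.arr Mem.mark := hag₂.arr _ (by decide)
  have n₂ : m₂.arr Mem.next = m₁.arr Mem.next := hag₂.arr _ (by decide)
  have v₂ : m₂.arr Mem.via = m₁.arr Mem.via := hag₂.arr _ (by decide)
  rw [k₁, g₁] at hstart
  refine Within.ite (t₁ := K * 20 + 40) (fun hne => ?_) (fun heq => ?_)
    (by simp only [Expr.cost]; omega)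
  · simp only [Expr.eval, hm₂.k] at hne
    rcases hstart with hstart | ⟨hjK, hj0, hjk⟩
    · omega
    refine Within.seq (t₂ := 20) (follow_spec (ρ := ρ) g₂ rfl hjK (d₂ ▸ hj0)
      (a₂ ▸ hgood.valid) (by rw [a₂, d₂, n₂, v₂]; exact hT)) ?_ (by omega)
    rintro m₃ hag₃ ⟨hval, hserved⟩
    have hm₃ := hm₂.agree hag₃
    have k₃ : m₃.arr Mem.key = m.arr Mem.key := (hag₃.arr _ (by decide)).trans k₂
    have g₃ : m₃.var Reg.g = g := (hag₃.var _ (by decide)).trans g₂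
    have s₃ : m₃.var Reg.start = m₂.var Reg.start := hag₃.var _ (by decide)
    obtain ⟨j, hj⟩ : ∃ j, j = m₂.var Reg.start := ⟨_, rfl⟩
    rw [← hj] at hjK hjk hserved s₃
    rw [a₂] at hserved
    have hjg : j ≠ g := by rintro rfl; omega
    have hkj := hgood.keys j hjK
    have hsj := hserved j
    rw [if_pos rfl, if_neg hjg] at hsj
    have hKj : K ≤ m.arr Mem.key j := by omega
    refine Within.exec ?_
    have hκ : ∀ f, (updateKeys.exec m₃).arr Mem.key f + (if f = j then K else 0) =
        m.arr Mem.key f + if f = g then K else 0 := by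
      intro f
      simp only [updateKeys, Prog.exec, Expr.eval, State.arr_setVar, State.arr_setArr,
        State.var_setArr, if_true, hm₃.k, g₃, s₃, k₃, Function.update_apply]
      rw [if_neg hjg.symm]
      by_cases h1 : f = g
      · subst h1; simp [hjg.symm]
      · by_cases h2 : f = j
        · subst h2; simp [h1]; omega
        · simp [h1, h2]
    have hA : (updateKeys.exec m₃).arr Mem.asg = m₃.arr Mem.asg := by
      simp [updateKeys, Prog.exec]
    have hG : (updateKeys.exec m₃).var Reg.g = 0 := by
      simp [updateKeys, Prog.exec, Expr.eval]
    rw [hG, hA]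
    refine ⟨⟨hval, fun f hf => ?_, fun f _ h _ hlt => absurd hlt (Nat.not_lt_zero _)⟩, ?_⟩
    · have h1 := hκ f
      have h2 := hgood.keys f hf
      have h3 := congrArg (K * ·) (hserved f)
      simp only [mul_add, mul_ite, mul_one, mul_zero] at h3
      omega
    · have hlt := sum_sq_lt (K := K) (by omega) (Finset.mem_range.2 hjK) (Finset.mem_range.2 hgK)
        hjk hκ
      have := Nat.mul_le_mul_right (K + 1) hlt
      rw [Nat.succ_mul] at this
      omega
  · simp only [Expr.eval, hm₂.k] at heq
    rcases hstart with ⟨-, hle⟩ | hstart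
    swap
    · omega
    refine Within.exec ?_ (by decide) (le_trans (by decide) (Nat.le_add_left 40 _))
    simp only [Prog.exec, Expr.eval, State.var_setVar, if_true, State.arr_setVar, a₂, k₂, g₂]
    refine ⟨⟨hgood.valid, hgood.keys, fun f hf h hh hlt hr => ?_⟩, by omega⟩
    rcases Nat.lt_succ_iff_lt_or_eq.1 hlt with hlt | rfl
    · exact hgood.stable f hf h hh hlt hr
    · exact hle f hf (marked_of_reach hT.root hcl hr)

/-- A bound on the number of steps of a search. -/
def searchTime {S : Type*} [CommSemiring S] (N K : S) : S :=
  (K * (K * N + K) ^ 2 * (K + 1) + K) *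
      ((2 * K + 1) * (K + 1) * (N * 40 + 40) + K * 54 + 90) +
    (K * 14 + N * (K * 20 + 30) + 30)

theorem search_spec (hm : Ctx R N K m) (hposK : ∀ f < K, pos f < K)
    (hpos : ∀ i < K, pos (m.arr Mem.io (m.var Reg.perm + i)) = i)
    (hsurj : ∀ f < K, ∃ i < K, m.arr Mem.io (m.var Reg.perm + i) = f) :
    Within search m (searchTime N K) fun m' =>
      Good R N K pos (m'.arr Mem.asg) (m'.arr Mem.key) K := by
  refine Within.seq (t₁ := K * 14 + N * (K * 20 + 30) + 12)
    (t₂ := (K * (K * N + K) ^ 2 * (K + 1) + K) *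
      ((2 * K + 1) * (K + 1) * (N * 40 + 40) + K * 54 + 90) + 18)
    (Q := fun m' => Valid R N K (m'.arr Mem.asg) ∧
      ∀ f < K, m'.arr Mem.key f = K * served N (m'.arr Mem.asg) f + pos f) ?_ ?_
    (by simp only [searchTime]; omega)
  · refine Within.seq (t₂ := N * (K * 20 + 30) + 6) (initKeys_spec hm.k hpos hsurj)
      (fun m₁ hag h₁ => ?_) (by omega)
    exact assignAll_spec (hm.agree hag) h₁
  · rintro m₁ hag₁ ⟨hval, hkey⟩
    have hm₁ := hm.agree hag₁
    refine Within.seq (t₁ := 2) (t₂ := (K * (K * N + K) ^ 2 * (K + 1) + K) *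
      ((2 * K + 1) * (K + 1) * (N * 40 + 40) + K * 54 + 90) + 16)
      (Q := fun m' => m' = m₁.setVar Reg.g 0) (Within.exec (by simp [Prog.exec, Expr.eval])) ?_
      (by omega)
    rintro m₂ hag₂ rfl
    have hm₂ := hm₁.agree hag₂
    refine (Within.loop (B := K * (K * N + K) ^ 2 * (K + 1) + K)
      (T := (2 * K + 1) * (K + 1) * (N * 40 + 40) + K * 54 + 80)
      (fun m' => Good R N K pos (m'.arr Mem.asg) (m'.arr Mem.key) (m'.var Reg.g))
      (fun m' => (∑ f ∈ Finset.range K, m'.arr Mem.key f ^ 2) * (K + 1) + (K - m'.var Reg.g))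
      ?_ ?_ ?_).mono ?_ ?_
    · refine ⟨hval, hkey, fun f _ h _ hlt => ?_⟩
      simp at hlt
    · have hle : ∑ f ∈ Finset.range K, m₁.arr Mem.key f ^ 2 ≤ K * (K * N + K) ^ 2 := by
        calc _ ≤ ∑ f ∈ Finset.range K, (K * N + K) ^ 2 := by
              refine Finset.sum_le_sum fun f hf => Nat.pow_le_pow_left ?_ 2
              rw [hkey f (Finset.mem_range.1 hf)]
              refine add_le_add (Nat.mul_le_mul_left K ?_) (hposK f (Finset.mem_range.1 hf)).le
              exact (Finset.card_filter_le _ _).trans_eq (Finset.card_range N)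
          _ = _ := by simp
      have := Nat.mul_le_mul_right (K + 1) hle
      simp only [State.arr_setVar]
      omega
    · intro m' hag hInv he
      have hm' := hm₂.agree hag
      simp only [Expr.eval, hm'.k] at he
      exact searchBody_spec hm' rfl (by omega) hInv
    · have hle : ∀ B T : ℕ, B * (T + 80 + (1 + 1 + 1) + 1) + (1 + 1 + 1) + 1 ≤
          B * (T + 90) + 16 := by
        intro B T
        have := Nat.mul_le_mul_left B (show T + 80 + (1 + 1 + 1) + 1 ≤ T + 90 by omega)
        omega
      exact hle _ _
    · rintro m' hag ⟨hInv, he⟩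
      have hm' := hm₂.agree hag
      simp only [Expr.eval, hm'.k] at he
      exact ⟨hInv.valid, hInv.keys, fun f hf h hh _ => hInv.stable f hf h hh (by omega)⟩

end Search

/-! ### The edge tables -/

namespace Favoring

open RAM RAM.Expr RAM.Prog Search

/-- Read the numbers of clients and facilities. -/
def readSizes : Prog :=
  seq (assign Reg.n (read Mem.io (const 0))) (assign Reg.k (read Mem.io (const 1)))

/-- Compute where the locations and the permutation start in the input, after `2 + n * n` and
`2 + n * n + k` numbers. -/
def findLocs : Prog :=
  seq (assign Reg.locs (const 2))
    (seq (forTo Reg.u Reg.n (assign Reg.locs (add (var Reg.locs) (var Reg.n))))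
      (assign Reg.perm (add (var Reg.locs) (var Reg.k))))

/-- The location of facility `Reg.f`. -/
def locF : Expr := read Mem.io (add (var Reg.locs) (var Reg.f))

/-- Nonzero if there is an edge from client `Reg.u` to the location of `Reg.f`, or if the two are
equal. -/
def edgeUF : Expr :=
  add (read Mem.io (add (var Reg.adj) locF))
    (sub (const 1) (add (sub (var Reg.u) locF) (sub locF (var Reg.u))))

def fillCell : Prog :=
  seq (write Mem.edge (add (var Reg.row) (var Reg.f)) edgeUF)
    (write Mem.live (add (var Reg.row) (var Reg.f))
      (read Mem.edge (add (var Reg.row) (var Reg.f))))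

def fillRow : Prog := forTo Reg.f Reg.k fillCell

/-- Fill both edge tables, in which client `u` and facility `f` have the cell `u * k + f`. -/
def fillTables : Prog :=
  seq (seq (assign Reg.row (const 0)) (assign Reg.adj (const 2)))
    (forTo Reg.u Reg.n (seq (write Mem.base (var Reg.u) (var Reg.row))
      (seq fillRow (seq (assign Reg.row (add (var Reg.row) (var Reg.k)))
        (assign Reg.adj (add (var Reg.adj) (var Reg.n)))))))

/-- Compute the number `4 * k * k * n` of client copies. -/
def countCopies : Prog :=
  seq (seq (assign Reg.quad (add (add (var Reg.k) (var Reg.k)) (add (var Reg.k) (var Reg.k))))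
    (assign Reg.copies (const 0)))
    (seq (forTo Reg.u Reg.k (assign Reg.copies (add (var Reg.copies) (var Reg.quad))))
      (seq (assign Reg.cnt (const 0))
        (forTo Reg.u Reg.copies (assign Reg.cnt (add (var Reg.cnt) (var Reg.n))))))

/-- Let the copies of a client share her row of the edge table: copy `u` belongs to client `u % n`. -/
def extendBase : Prog :=
  forTo Reg.u Reg.cnt (ite (sub (add (var Reg.u) (const 1)) (var Reg.n))
    (write Mem.base (var Reg.u) (read Mem.base (sub (var Reg.u) (var Reg.n)))) skip)

/-- Remove the live edge between client `Reg.u` and facility `Reg.f` if the client has an edge to some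
facility whose load is much smaller. -/
def cutCell : Prog :=
  forTo Reg.h Reg.k (ite (read Mem.edge (add (read Mem.base (var Reg.u)) (var Reg.h)))
    (ite (sub (read Mem.key (var Reg.f))
        (add (read Mem.key (var Reg.h)) (add (var Reg.k) (var Reg.k))))
      (write Mem.live (add (read Mem.base (var Reg.u)) (var Reg.f)) (const 0)) skip) skip)

/-- Removal of the edges that leave the classes, by comparison of the keys. -/
def cut : Prog := forTo Reg.u Reg.n (forTo Reg.f Reg.k cutCell)

/-- Write the facility of each client, shifted by one, or `0` for the dummy facility. -/
def output : Prog :=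
  seq (forTo Reg.u Reg.n (ite (sub (var Reg.k) (read Mem.asg (var Reg.u)))
    (write Mem.io (var Reg.u) (add (read Mem.asg (var Reg.u)) (const 1)))
    (write Mem.io (var Reg.u) (const 0)))) (assign Reg.len (var Reg.n))

variable {n k : ℕ} {m : State}

theorem readSizes_spec (hn : m.arr Mem.io 0 = n) (hk : m.arr Mem.io 1 = k) :
    Within readSizes m 6 fun m' => m'.var Reg.n = n ∧ m'.var Reg.k = k := by
  refine Within.exec ?_
  simp [readSizes, Prog.exec, Expr.eval, hn, hk]

theorem findLocs_spec (hn : m.var Reg.n = n) (hk : m.var Reg.k = k) :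
    Within findLocs m (n * 12 + 12) fun m' => m'.var Reg.locs = 2 + n * n ∧
      m'.var Reg.perm = 2 + n * n + k := by
  refine Within.seq (t₁ := 2) (t₂ := n * 12 + 10) (Q := fun m' => m' = m.setVar Reg.locs 2)
    (Within.exec (by simp [Prog.exec, Expr.eval])) ?_ (by omega)
  rintro m₁ hag₁ rfl
  refine Within.seq (t₁ := n * (4 + 8) + 6) (t₂ := 4) (Q := fun m' => m'.var Reg.locs = 2 + n * n)
    (Within.forTo (fun i m' => m'.var Reg.locs = 2 + i * n) (by simpa using hn) (by simp) ?_) ?_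
    (by omega)
  · intro i hi m' hag hx hInv
    refine Within.exec ?_
    have e1 : m'.var Reg.n = n := (hag.var _ (by decide)).trans (by simpa using hn)
    simp only [Prog.exec, Expr.eval, hInv, e1, State.var_setVar]
    simp
    ring
  · intro m₂ hag₂ h₂
    have e1 : m₂.var Reg.k = k := (hag₂.var _ (by decide)).trans (by simpa using hk)
    refine Within.exec ?_
    simp [Prog.exec, Expr.eval, h₂, e1]

/-- Whether client `u` attracts facility `f`, as read from the input. -/
def InputEdge (io : ℕ → ℕ) (n locs u f : ℕ) : Prop :=
  io (2 + u * n + io (locs + f)) ≠ 0 ∨ u = io (locs + f)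

theorem fillRow_spec {u : ℕ} (hk : m.var Reg.k = k) (hu : m.var Reg.u = u)
    (hrow : m.var Reg.row = u * k) (hadj : m.var Reg.adj = 2 + u * n) :
    Within fillRow m (k * 50 + 6) fun m' =>
      (∀ x < u * k, m'.arr Mem.edge x = m.arr Mem.edge x ∧ m'.arr Mem.live x = m.arr Mem.live x) ∧
      ∀ f < k, (m'.arr Mem.edge (u * k + f) ≠ 0 ↔
          InputEdge (m.arr Mem.io) n (m.var Reg.locs) u f) ∧
        (m'.arr Mem.live (u * k + f) ≠ 0 ↔
          InputEdge (m.arr Mem.io) n (m.var Reg.locs) u f) := by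
  refine (Within.forTo (T := 42) (fun i m' =>
    (∀ x < u * k, m'.arr Mem.edge x = m.arr Mem.edge x ∧ m'.arr Mem.live x = m.arr Mem.live x) ∧
      ∀ f < i, (m'.arr Mem.edge (u * k + f) ≠ 0 ↔
          InputEdge (m.arr Mem.io) n (m.var Reg.locs) u f) ∧
        (m'.arr Mem.live (u * k + f) ≠ 0 ↔
          InputEdge (m.arr Mem.io) n (m.var Reg.locs) u f)) hk (by simp) ?_).mono le_rfl
    fun _ _ h => h
  intro i hi m' hag hx hInv
  have e1 : m'.var Reg.u = u := (hag.var _ (by decide)).trans hu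
  have e2 : m'.var Reg.row = u * k := (hag.var _ (by decide)).trans hrow
  have e3 : m'.var Reg.adj = 2 + u * n := (hag.var _ (by decide)).trans hadj
  have e4 : m'.var Reg.locs = m.var Reg.locs := hag.var _ (by decide)
  have e5 : m'.arr Mem.io = m.arr Mem.io := hag.arr _ (by decide)
  have hedge : edgeUF.eval m' ≠ 0 ↔ InputEdge (m.arr Mem.io) n (m.var Reg.locs) u i := by
    simp only [edgeUF, locF, Expr.eval, hx, e1, e3, e4, e5, InputEdge]
    omega
  refine Within.exec ?_
  simp [fillCell, Prog.exec, Expr.eval, hx, e2]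
  refine ⟨fun x hxu => ?_, fun f hf => ?_⟩
  · have hne : x ≠ u * k + i := by omega
    simpa [Function.update_of_ne hne] using hInv.1 x hxu
  · by_cases hfi : f = i
    · subst hfi
      simpa using hedge
    · have hne : u * k + f ≠ u * k + i := by omega
      simpa [Function.update_of_ne hne] using hInv.2 f (by omega)

theorem fillTables_spec (hn : m.var Reg.n = n) (hk : m.var Reg.k = k) :
    Within fillTables m (n * (k * 50 + 40) + 12) fun m' => ∀ u < n, m'.arr Mem.base u = u * k ∧
      ∀ f < k, (m'.arr Mem.edge (u * k + f) ≠ 0 ↔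
          InputEdge (m.arr Mem.io) n (m.var Reg.locs) u f) ∧
        (m'.arr Mem.live (u * k + f) ≠ 0 ↔
          InputEdge (m.arr Mem.io) n (m.var Reg.locs) u f) := by
  refine Within.seq (t₁ := 4) (t₂ := n * (k * 50 + 30 + 8) + 6) (Q := fun m' =>
    m' = (m.setVar Reg.row 0).setVar Reg.adj 2) (Within.exec (by simp [Prog.exec, Expr.eval])) ?_
    (by rw [mul_add, mul_add, mul_add]; omega)
  rintro m₁ hag₁ rfl
  refine (Within.forTo (T := k * 50 + 30) (fun i m' => m'.var Reg.row = i * k ∧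
    m'.var Reg.adj = 2 + i * n ∧ ∀ u < i, m'.arr Mem.base u = u * k ∧
      ∀ f < k, (m'.arr Mem.edge (u * k + f) ≠ 0 ↔
          InputEdge (m.arr Mem.io) n (m.var Reg.locs) u f) ∧
        (m'.arr Mem.live (u * k + f) ≠ 0 ↔
          InputEdge (m.arr Mem.io) n (m.var Reg.locs) u f)) (by simpa using hn) (by simp)
      ?_).mono le_rfl fun _ _ h => h.2.2
  intro i hi m' hag hx ⟨hrow, hadj, hInv⟩
  have e1 : m'.var Reg.k = k := (hag.var _ (by decide)).trans (by simpa using hk)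
  have e2 : m'.var Reg.n = n := (hag.var _ (by decide)).trans (by simpa using hn)
  have e3 : m'.var Reg.locs = m.var Reg.locs := (hag.var _ (by decide)).trans (by simp)
  have e4 : m'.arr Mem.io = m.arr Mem.io := hag.arr _ (by decide)
  refine Within.seq (t₁ := 3) (t₂ := k * 50 + 20) (Q := fun m₂ =>
    m₂ = m'.setArr Mem.base i (i * k)) (Within.exec ?_) ?_ (by omega)
  · simp [Prog.exec, Expr.eval, hx, hrow]
  rintro m₂ hag₂ rfl
  refine Within.seq (t₂ := 8) (fillRow_spec (u := i) (n := n) (k := k) (by simpa using e1)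
    (by simpa using hx) (by simpa using hrow) (by simpa using hadj)) ?_ (by omega)
  intro m₃ hag₃ ⟨h1, h2⟩
  have f1 : m₃.var Reg.k = k := (hag₃.var _ (by decide)).trans (by simpa using e1)
  have f2 : m₃.var Reg.n = n := (hag₃.var _ (by decide)).trans (by simpa using e2)
  have f3 : m₃.arr Mem.base = Function.update (m'.arr Mem.base) i (i * k) :=
    (hag₃.arr _ (by decide)).trans (by simp)
  have f4 : m₃.var Reg.row = i * k := (hag₃.var _ (by decide)).trans (by simpa using hrow)
  have f5 : m₃.var Reg.adj = 2 + i * n := (hag₃.var _ (by decide)).trans (by simpa using hadj)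
  refine Within.exec ?_
  simp [Prog.exec, Expr.eval, f1, f2, f4, f5]
  simp [e3, e4] at h1 h2
  refine ⟨by ring, by ring, fun u hu => ?_⟩
  by_cases hui : u = i
  · subst hui
    exact ⟨by rw [f3]; simp, fun f hf => by simpa using h2 f hf⟩
  · have hlt : u < i := by omega
    have h3 := hInv u hlt
    refine ⟨by rw [f3, Function.update_of_ne hui]; exact h3.1, fun f hf => ?_⟩
    have hx : u * k + f < i * k := by
      have := Nat.mul_le_mul_right k hlt
      rw [Nat.succ_mul] at this
      omega
    rw [(h1 _ hx).1, (h1 _ hx).2]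
    simpa using h3.2 f hf

theorem countCopies_spec (hn : m.var Reg.n = n) (hk : m.var Reg.k = k) :
    Within countCopies m (k * 12 + 4 * k * k * 12 + 30) fun m' =>
      m'.var Reg.cnt = 4 * k * k * n := by
  refine Within.seq (t₁ := 10) (t₂ := k * 12 + 4 * k * k * 12 + 20) (Q := fun m' => m' =
    (m.setVar Reg.quad (4 * k)).setVar Reg.copies 0) (Within.exec ?_) ?_ (by omega)
  · simp only [Prog.exec, Expr.eval, hk, show k + k + (k + k) = 4 * k by ring]
  rintro m₁ hag₁ rfl
  refine Within.seq (t₁ := k * (4 + 8) + 6) (t₂ := 4 * k * k * 12 + 10)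
    (Q := fun m' => m'.var Reg.copies = 4 * k * k)
    ((Within.forTo (fun i m' => m'.var Reg.copies = 4 * k * i) (by simpa using hk) (by simp)
      ?_)) ?_ (by omega)
  · intro i hi m' hag hx hInv
    have e1 : m'.var Reg.quad = 4 * k := (hag.var _ (by decide)).trans (by simp)
    refine Within.exec ?_
    simp [Prog.exec, Expr.eval, hInv, e1]
    ring
  intro m₂ hag₂ h₂
  have e2 : m₂.var Reg.n = n := (hag₂.var _ (by decide)).trans (by simpa using hn)
  refine Within.seq (t₁ := 2) (t₂ := 4 * k * k * (4 + 8) + 6)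
    (Q := fun m' => m' = m₂.setVar Reg.cnt 0)
    (Within.exec (by simp [Prog.exec, Expr.eval])) ?_ (by omega)
  rintro m₃ hag₃ rfl
  refine Within.forTo (fun i m' => m'.var Reg.cnt = i * n) (by simpa using h₂) (by simp) ?_
  intro i hi m' hag hx hInv
  have e1 : m'.var Reg.n = n := (hag.var _ (by decide)).trans (by simpa using e2)
  refine Within.exec ?_
  simp [Prog.exec, Expr.eval, hInv, e1]
  ring

theorem extendBase_spec {N : ℕ} (hn : m.var Reg.n = n) (hN : m.var Reg.cnt = N)
    (hnN : n = 0 → N = 0) (hbase : ∀ u < n, m.arr Mem.base u = u * k) :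
    Within extendBase m (N * 30 + 6) fun m' =>
      ∀ u, u < N ∨ u < n → m'.arr Mem.base u = (u % n) * k := by
  refine (Within.forTo (T := 22) (fun i m' => ∀ u, u < i ∨ u < n →
    m'.arr Mem.base u = (u % n) * k) hN ?_ ?_).mono le_rfl fun _ _ h => h
  · intro u hu
    have hu : u < n := by omega
    simp [hbase u hu, Nat.mod_eq_of_lt hu]
  · intro i hi m' hag hx hInv
    have e1 : m'.var Reg.n = n := (hag.var _ (by decide)).trans hn
    refine Within.exec ?_
    simp only [Prog.exec, Expr.eval, hx, e1]
    split_ifs with h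
    · intro u hu
      exact hInv u (by omega)
    · intro u hu
      simp only [State.arr_setVar, State.arr_setArr, if_true]
      by_cases hui : u = i
      · subst hui
        rw [Function.update_self, Nat.mod_eq_sub_mod (by omega)]
        exact hInv _ (by omega)
      · rw [Function.update_of_ne hui]
        exact hInv u (by omega)

end Favoring

/-! ### Restriction to the classes, and output -/

namespace Favoring

open RAM RAM.Expr RAM.Prog Search

variable {n k : ℕ} {m : State}

theorem cutCell_spec {b f : ℕ} (hk : m.var Reg.k = k) (hb : m.arr Mem.base (m.var Reg.u) = b)
    (hf : m.var Reg.f = f) :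
    Within cutCell m (k * 30 + 6) fun m' =>
      (∀ x, x ≠ b + f → m'.arr Mem.live x = m.arr Mem.live x) ∧
      (m'.arr Mem.live (b + f) ≠ 0 ↔ m.arr Mem.live (b + f) ≠ 0 ∧ ∀ h < k,
        m.arr Mem.edge (b + h) ≠ 0 → m.arr Mem.key f ≤ m.arr Mem.key h + 2 * k) := by
  refine (Within.forTo (T := 22) (fun i m' =>
      (∀ x, x ≠ b + f → m'.arr Mem.live x = m.arr Mem.live x) ∧
      (m'.arr Mem.live (b + f) ≠ 0 ↔ m.arr Mem.live (b + f) ≠ 0 ∧ ∀ h < i,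
        m.arr Mem.edge (b + h) ≠ 0 → m.arr Mem.key f ≤ m.arr Mem.key h + 2 * k)) hk (by simp)
      ?_).mono le_rfl fun _ _ h => h
  intro i hi m' hag hx ⟨h1, h2⟩
  have e1 : m'.var Reg.k = k := (hag.var _ (by decide)).trans hk
  have e2 : m'.var Reg.u = m.var Reg.u := hag.var _ (by decide)
  have e3 : m'.var Reg.f = f := (hag.var _ (by decide)).trans hf
  have e4 : m'.arr Mem.base = m.arr Mem.base := hag.arr _ (by decide)
  have e5 : m'.arr Mem.edge = m.arr Mem.edge := hag.arr _ (by decide)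
  have e6 : m'.arr Mem.key = m.arr Mem.key := hag.arr _ (by decide)
  have hkeep : (m.arr Mem.edge (b + i) ≠ 0 → m.arr Mem.key f ≤ m.arr Mem.key i + 2 * k) →
      (m'.arr Mem.live (b + f) ≠ 0 ↔ m.arr Mem.live (b + f) ≠ 0 ∧ ∀ h < i + 1,
        m.arr Mem.edge (b + h) ≠ 0 → m.arr Mem.key f ≤ m.arr Mem.key h + 2 * k) := by
    intro hi
    rw [h2]
    refine and_congr_right fun _ => ⟨fun h x hx => ?_, fun h x hx => h x (by omega)⟩
    rcases Nat.lt_succ_iff_lt_or_eq.1 hx with hx | rfl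
    · exact h x hx
    · exact hi
  refine Within.exec ?_
  simp only [Prog.exec, Expr.eval, hx, e1, e2, e3, e4, e5, e6, hb]
  split_ifs with h3 h4
  · exact ⟨h1, hkeep fun h => absurd h3 h⟩
  · exact ⟨h1, hkeep fun _ => by omega⟩
  · simp only [State.arr_setVar, State.arr_setArr, if_true, Function.update_self]
    refine ⟨fun x hx => by rw [Function.update_of_ne hx]; exact h1 x hx, ?_⟩
    refine iff_of_false (fun h => h rfl) fun h => ?_
    have := h.2 i (Nat.lt_succ_self i) h3
    omega

theorem cutRow_spec {b : ℕ} (hk : m.var Reg.k = k) (hb : m.arr Mem.base (m.var Reg.u) = b) :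
    Within (forTo Reg.f Reg.k cutCell) m (k * (k * 30 + 14) + 6) fun m' =>
      (∀ x, (∀ f < k, x ≠ b + f) → m'.arr Mem.live x = m.arr Mem.live x) ∧
      ∀ f < k, (m'.arr Mem.live (b + f) ≠ 0 ↔ m.arr Mem.live (b + f) ≠ 0 ∧ ∀ h < k,
        m.arr Mem.edge (b + h) ≠ 0 → m.arr Mem.key f ≤ m.arr Mem.key h + 2 * k) := by
  refine (Within.forTo (T := k * 30 + 6) (fun i m' =>
      (∀ x, (∀ f < i, x ≠ b + f) → m'.arr Mem.live x = m.arr Mem.live x) ∧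
      ∀ f < i, (m'.arr Mem.live (b + f) ≠ 0 ↔ m.arr Mem.live (b + f) ≠ 0 ∧ ∀ h < k,
        m.arr Mem.edge (b + h) ≠ 0 → m.arr Mem.key f ≤ m.arr Mem.key h + 2 * k)) hk (by simp)
      ?_).mono le_rfl fun _ _ h => h
  intro i hi m' hag hx ⟨h1, h2⟩
  have e1 : m'.var Reg.k = k := (hag.var _ (by decide)).trans hk
  have e2 : m'.var Reg.u = m.var Reg.u := hag.var _ (by decide)
  have e4 : m'.arr Mem.base = m.arr Mem.base := hag.arr _ (by decide)
  have e5 : m'.arr Mem.edge = m.arr Mem.edge := hag.arr _ (by decide)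
  have e6 : m'.arr Mem.key = m.arr Mem.key := hag.arr _ (by decide)
  refine (cutCell_spec e1 (b := b) (by rw [e4, e2]; exact hb) hx).mono le_rfl ?_
  rintro m'' _ ⟨h3, h4⟩
  rw [e5, e6] at h4
  simp only [State.arr_setVar]
  refine ⟨fun x hx => ?_, fun f hf => ?_⟩
  · rw [h3 x (hx i (Nat.lt_succ_self i)), h1 x fun f hf => hx f (by omega)]
  · rcases Nat.lt_succ_iff_lt_or_eq.1 hf with hf | rfl
    · rw [h3 _ (by omega)]
      exact h2 f hf
    · rw [h4, h1 _ fun f hf => by omega]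

theorem cut_spec (hn : m.var Reg.n = n) (hk : m.var Reg.k = k)
    (hbase : ∀ u < n, m.arr Mem.base u = u * k) :
    Within cut m (n * (k * (k * 30 + 14) + 14) + 6) fun m' => ∀ u < n, ∀ f < k,
      (m'.arr Mem.live (u * k + f) ≠ 0 ↔ m.arr Mem.live (u * k + f) ≠ 0 ∧ ∀ h < k,
        m.arr Mem.edge (u * k + h) ≠ 0 → m.arr Mem.key f ≤ m.arr Mem.key h + 2 * k) := by
  refine (Within.forTo (T := k * (k * 30 + 14) + 6) (fun i m' =>
      (∀ x, i * k ≤ x → m'.arr Mem.live x = m.arr Mem.live x) ∧ ∀ u < i, ∀ f < k,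
      (m'.arr Mem.live (u * k + f) ≠ 0 ↔ m.arr Mem.live (u * k + f) ≠ 0 ∧ ∀ h < k,
        m.arr Mem.edge (u * k + h) ≠ 0 → m.arr Mem.key f ≤ m.arr Mem.key h + 2 * k)) hn (by simp)
      ?_).mono le_rfl fun _ _ h => h.2
  intro i hi m' hag hx ⟨h1, h2⟩
  have e1 : m'.var Reg.k = k := (hag.var _ (by decide)).trans hk
  have e4 : m'.arr Mem.base = m.arr Mem.base := hag.arr _ (by decide)
  have e5 : m'.arr Mem.edge = m.arr Mem.edge := hag.arr _ (by decide)
  have e6 : m'.arr Mem.key = m.arr Mem.key := hag.arr _ (by decide)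
  refine (cutRow_spec e1 (b := i * k) (by rw [e4, hx]; exact hbase i hi)).mono le_rfl ?_
  rintro m'' _ ⟨h3, h4⟩
  rw [e5, e6] at h4
  simp only [State.arr_setVar]
  refine ⟨fun x hx => ?_, fun u hu f hf => ?_⟩
  · rw [Nat.succ_mul] at hx
    rw [h3 x fun f hf => by omega, h1 x (by omega)]
  · rcases Nat.lt_succ_iff_lt_or_eq.1 hu with hu | rfl
    · rw [h3 _ fun f' hf' => ?_]
      · exact h2 u hu f hf
      · have := Nat.mul_le_mul_right k hu
        rw [Nat.succ_mul] at this
        omega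
    · rw [h4 f hf, h1 _ (by omega)]

theorem output_spec (hn : m.var Reg.n = n) (hk : m.var Reg.k = k) :
    Within output m (n * 24 + 8) fun m' => m'.var Reg.len = n ∧ ∀ u < n,
      m'.arr Mem.io u = if m.arr Mem.asg u < k then m.arr Mem.asg u + 1 else 0 := by
  refine Within.seq (t₁ := n * (16 + 8) + 6) (t₂ := 2) (Q := fun m' => m'.var Reg.n = n ∧
    ∀ u < n, m'.arr Mem.io u = if m.arr Mem.asg u < k then m.arr Mem.asg u + 1 else 0)
    ((Within.forTo (fun i m' => ∀ u < i,
    m'.arr Mem.io u = if m.arr Mem.asg u < k then m.arr Mem.asg u + 1 else 0) hn (by simp)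
    ?_).mono le_rfl fun m' hag h => ⟨(hag.var _ (by decide)).trans hn, h⟩) ?_ (by omega)
  · intro i hi m' hag hx hInv
    have e1 : m'.var Reg.k = k := (hag.var _ (by decide)).trans hk
    have e2 : m'.arr Mem.asg = m.arr Mem.asg := hag.arr _ (by decide)
    refine Within.exec ?_
    intro u hu
    simp only [Prog.exec, Expr.eval, hx, e1, e2]
    by_cases hui : u = i
    · subst hui
      split_ifs <;> first | omega | simp
    · have := hInv u (by omega)
      rw [← this]
      split_ifs <;> simp [Function.update_of_ne hui]
  · rintro m₁ _ ⟨h1, h2⟩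
    refine Within.exec ?_
    refine ⟨by simp [Prog.exec, Expr.eval, h1], fun u hu => ?_⟩
    simpa [Prog.exec] using h2 u hu

/-! ### The stable assignment found by a search -/

/-- The assignment stored in the memory; values from `k` on stand for no facility. -/
def toAssignment (N k : ℕ) (A : ℕ → ℕ) (u : Fin N) : Option (Fin k) :=
  if h : A u < k then some ⟨A u, h⟩ else none

theorem toAssignment_eq_some {N : ℕ} {A : ℕ → ℕ} {u : Fin N} {f : Fin k} :
    toAssignment N k A u = some f ↔ A u = f := by
  unfold toAssignment
  split_ifs with h
  · simp [Fin.ext_iff]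
  · simp only [false_iff]
    have := f.2
    omega

theorem loadOf_toAssignment {N : ℕ} {A : ℕ → ℕ} (f : Fin k) :
    loadOf (toAssignment N k A) f = served N A f := by
  unfold loadOf served
  simp only [toAssignment_eq_some]
  refine Finset.card_bij (fun u _ => (u : ℕ)) ?_ ?_ ?_
  · intro u hu
    simpa using hu
  · intro u _ v _ h
    exact Fin.ext h
  · intro u hu
    simp only [Finset.mem_filter, Finset.mem_range] at hu
    exact ⟨⟨u, hu.1⟩, by simpa using hu.2, rfl⟩

theorem isStable_toAssignment {N : ℕ} {R : ℕ → ℕ → Prop} {pos A key : ℕ → ℕ}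
    (h : Good R N k pos A key k) {E : Fin N → Fin k → Prop} (hE : ∀ u f, E u f ↔ R u f) :
    IsStable E (fun f => pos f) k (toAssignment N k A) := by
  refine ⟨fun u f hf => ?_, fun u f hEf => ?_, fun f g hr => ?_⟩
  · rw [toAssignment_eq_some] at hf
    rcases h.valid u u.2 with h1 | h1
    · rw [hE, ← hf]; exact h1.2
    · have := f.2
      omega
  · rcases h.valid u u.2 with h1 | h1
    · exact ⟨⟨A u, h1.1⟩, toAssignment_eq_some.2 rfl⟩
    · exact absurd ((hE u f).1 hEf) (h1.2 f f.2)
  · have h1 := h.stable f f.2 g g.2 g.2 (hr.lift Fin.val ?_)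
    · rw [h.keys f f.2, h.keys g g.2] at h1
      rw [loadOf_toAssignment, loadOf_toAssignment]
      omega
    · rintro a b ⟨u, hu, hEu⟩
      exact ⟨u, u.2, toAssignment_eq_some.1 hu, b.2, (hE u b).1 hEu⟩

/-- With `c * n` copies, each client has `c` of them. -/
theorem card_filter_modNat {c : ℕ} (X : Finset (Fin n)) :
    (Finset.univ.filter fun ω : Fin (c * n) => ω.modNat ∈ X).card = c * X.card := by
  rw [Finset.card_equiv (t := (Finset.univ : Finset (Fin c)) ×ˢ X) finProdFinEquiv.symm]
  · simp
  · intro ω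
    simp [finProdFinEquiv]

/-! ### The layout of the input -/

/-- A list of rows of equal length, read as a table. -/
theorem getD_flatMap {α : Type*} (l : List α) (φ : α → List ℕ) (b : ℕ)
    (hφ : ∀ x ∈ l, (φ x).length = b) (u v : ℕ) (hu : u < l.length) (hv : v < b) :
    (l.flatMap φ).getD (u * b + v) 0 = (φ l[u]).getD v 0 := by
  induction l generalizing u with
  | nil => simp at hu
  | cons x l ih =>
    have hx := hφ x (by simp)
    rw [List.flatMap_cons]
    cases u with
    | zero => rw [List.getD_append _ _ _ _ (by omega)]; simp
    | succ u =>
      rw [List.getD_append_right _ _ _ _ (by rw [hx, Nat.succ_mul]; omega), hx,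
        show (u + 1) * b + v - b = u * b + v by rw [Nat.succ_mul]; omega]
      exact ih (fun y hy => hφ y (by simp [hy])) u (by simpa using hu)

section Input

variable (H : Digraph (Fin n)) (s : Fin k → Fin n) (π : Equiv.Perm (Fin k))

open Classical in
theorem length_adjacency : ((List.finRange n).flatMap fun u => (List.finRange n).map fun v =>
    if H.Adj u v then 1 else 0).length = n * n := by
  simp [List.length_flatMap]

theorem length_encodeInput : (encodeInput H s π).length = 2 + n * n + k + k := by
  classical
  unfold encodeInput
  simp only [List.length_append, List.length_map, List.length_finRange, List.length_cons,
    List.length_nil]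
  rw [length_adjacency]

open Classical in
theorem encodeInput_adj (u v : Fin n) :
    (encodeInput H s π).getD (2 + u * n + v) 0 = if H.Adj u v then 1 else 0 := by
  have huv : (u : ℕ) * n + v < n * n := by
    have h1 := Nat.mul_le_mul_right n u.2
    rw [Nat.succ_mul] at h1
    have h2 := v.2
    omega
  have hlen := length_adjacency H
  unfold encodeInput
  rw [List.getD_append _ _ _ _ (by simp [hlen]; omega),
    List.getD_append _ _ _ _ (by simp [hlen]; omega), List.getD_append_right _ _ _ _ (by simp; omega),
    show 2 + (u : ℕ) * n + v - [n, k].length = u * n + v by simp; omega,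
    getD_flatMap _ _ n (by simp) _ _ (by simp) v.2]
  simp

theorem encodeInput_loc (f : Fin k) :
    (encodeInput H s π).getD (2 + n * n + f) 0 = s f := by
  classical
  have hlen := length_adjacency H
  have hf := f.2
  unfold encodeInput
  rw [List.getD_append _ _ _ _ (by simp [hlen]; omega),
    List.getD_append_right _ _ _ _ (by simp [hlen]; omega)]
  simp [hlen, show n * n + 2 = 2 + n * n by ring]

theorem encodeInput_perm (i : Fin k) :
    (encodeInput H s π).getD (2 + n * n + k + i) 0 = π i := by
  classical
  have hlen := length_adjacency H
  unfold encodeInput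
  rw [List.getD_append_right _ _ _ _ (by simp [hlen]; omega)]
  have hidx : 2 + n * n + k + (i : ℕ) - (n * n + k + 1 + 1) = i := by omega
  simp [hlen, hidx]

end Input

end Favoring

/-! ### The algorithm -/

namespace Favoring

open RAM RAM.Expr RAM.Prog Search

variable {n k : ℕ} {m : State}

/-- Set up the edge tables and the client copies. -/
def prepare : Prog :=
  seq readSizes (seq findLocs (seq fillTables (seq countCopies extendBase)))

/-- The algorithm finds the classes by a search with `4 * k ^ 2` copies of each client, and then
searches for a stable assignment of the clients within the classes. -/
def algorithm : Prog :=
  seq prepare (seq search (seq cut (seq (assign Reg.cnt (var Reg.n)) (seq search output))))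

/-- The memory after the edge tables have been set up for the input `io`. -/
structure Prepared (io : ℕ → ℕ) (n k : ℕ) (m : State) : Prop where
  var_n : m.var Reg.n = n
  var_k : m.var Reg.k = k
  perm : m.var Reg.perm = 2 + n * n + k
  arr_io : m.arr Mem.io = io
  base : ∀ u, u < 4 * k * k * n ∨ u < n → m.arr Mem.base u = (u % n) * k
  edge : ∀ u < n, ∀ f < k, m.arr Mem.edge (u * k + f) ≠ 0 ↔ InputEdge io n (2 + n * n) u f

/-- A bound on the number of steps of the preparations. It is defined over semirings, as are the other
time bounds, so that it can be evaluated at the polynomial `X`. -/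
def prepareTime {S : Type*} [CommSemiring S] (n k : S) : S :=
  n * 12 + n * (k * 50 + 40) + k * 12 + 4 * k * k * 12 + 4 * k * k * n * 30 + 100

theorem prepare_spec {io : ℕ → ℕ} (hio : m.arr Mem.io = io) (hn : io 0 = n) (hk : io 1 = k) :
    Within prepare m (prepareTime n k) fun m' => Prepared io n k m' ∧
      m'.var Reg.cnt = 4 * k * k * n ∧ ∀ u < n, ∀ f < k,
        (m'.arr Mem.live (u * k + f) ≠ 0 ↔ InputEdge io n (2 + n * n) u f) := by
  refine Within.seq (t₂ := n * 12 + n * (k * 50 + 40) + k * 12 + 4 * k * k * 12 +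
    4 * k * k * n * 30 + 80) (readSizes_spec (hio ▸ hn) (hio ▸ hk)) ?_
    (by simp only [prepareTime]; omega)
  intro m₁ a₁ ⟨n₁, k₁⟩
  have i₁ : m₁.arr Mem.io = io := (a₁.arr _ (by decide)).trans hio
  refine Within.seq (t₂ := n * (k * 50 + 40) + k * 12 + 4 * k * k * 12 +
    4 * k * k * n * 30 + 60) (findLocs_spec n₁ k₁) ?_ (by omega)
  intro m₂ a₂ ⟨l₂, p₂⟩
  have i₂ : m₂.arr Mem.io = io := (a₂.arr _ (by decide)).trans i₁
  have n₂ : m₂.var Reg.n = n := (a₂.var _ (by decide)).trans n₁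
  have k₂ : m₂.var Reg.k = k := (a₂.var _ (by decide)).trans k₁
  refine Within.seq (t₂ := k * 12 + 4 * k * k * 12 + 4 * k * k * n * 30 + 40)
    (fillTables_spec n₂ k₂) ?_ (by omega)
  intro m₃ a₃ h₃
  rw [i₂, l₂] at h₃
  have i₃ : m₃.arr Mem.io = io := (a₃.arr _ (by decide)).trans i₂
  have n₃ : m₃.var Reg.n = n := (a₃.var _ (by decide)).trans n₂
  have k₃ : m₃.var Reg.k = k := (a₃.var _ (by decide)).trans k₂
  have p₃ : m₃.var Reg.perm = 2 + n * n + k := (a₃.var _ (by decide)).trans p₂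
  refine Within.seq (t₂ := 4 * k * k * n * 30 + 6) (countCopies_spec n₃ k₃) ?_ (by omega)
  intro m₄ a₄ c₄
  have i₄ : m₄.arr Mem.io = io := (a₄.arr _ (by decide)).trans i₃
  have n₄ : m₄.var Reg.n = n := (a₄.var _ (by decide)).trans n₃
  have k₄ : m₄.var Reg.k = k := (a₄.var _ (by decide)).trans k₃
  have p₄ : m₄.var Reg.perm = 2 + n * n + k := (a₄.var _ (by decide)).trans p₃
  have b₄ : m₄.arr Mem.base = m₃.arr Mem.base := a₄.arr _ (by decide)
  have e₄ : m₄.arr Mem.edge = m₃.arr Mem.edge := a₄.arr _ (by decide)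
  have l₄ : m₄.arr Mem.live = m₃.arr Mem.live := a₄.arr _ (by decide)
  refine (extendBase_spec (k := k) n₄ c₄ (by rintro rfl; simp)
    fun u hu => by rw [b₄]; exact (h₃ u hu).1).mono le_rfl ?_
  intro m₅ a₅ h₅
  have e₅ : m₅.arr Mem.edge = m₃.arr Mem.edge := (a₅.arr _ (by decide)).trans e₄
  have l₅ : m₅.arr Mem.live = m₃.arr Mem.live := (a₅.arr _ (by decide)).trans l₄
  refine ⟨⟨(a₅.var _ (by decide)).trans n₄, (a₅.var _ (by decide)).trans k₄,
    (a₅.var _ (by decide)).trans p₄, (a₅.arr _ (by decide)).trans i₄, h₅, ?_⟩,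
    (a₅.var _ (by decide)).trans c₄, ?_⟩
  · intro u hu f hf
    rw [e₅]
    exact ((h₃ u hu).2 f hf).1
  · intro u hu f hf
    rw [l₅]
    exact ((h₃ u hu).2 f hf).2

theorem Prepared.agree {io : ℕ → ℕ} (h : Prepared io n k m) {P : Prog} {m' : State}
    (ha : Agree P m m') (h1 : P.setsVar Reg.n = false := by decide)
    (h2 : P.setsVar Reg.k = false := by decide) (h3 : P.setsVar Reg.perm = false := by decide)
    (h4 : P.setsArr Mem.io = false := by decide) (h5 : P.setsArr Mem.base = false := by decide)
    (h6 : P.setsArr Mem.edge = false := by decide) : Prepared io n k m' := by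
  refine ⟨(ha.var _ h1).trans h.var_n, (ha.var _ h2).trans h.var_k, (ha.var _ h3).trans h.perm,
    (ha.arr _ h4).trans h.arr_io, ?_, ?_⟩
  · rw [ha.arr _ h5]; exact h.base
  · rw [ha.arr _ h6]; exact h.edge

/-- A bound on the number of steps of the algorithm. -/
def algorithmTime {S : Type*} [CommSemiring S] (n k : S) : S :=
  prepareTime n k + searchTime (4 * k * k * n) k + n * (k * (k * 30 + 14) + 14) +
    searchTime n k + n * 24 + 30

section Run

variable (I : FLG n k) (s : Fin k → Fin n) (π : Equiv.Perm (Fin k))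

/-- The positions of the facilities in the permutation, with the irrelevant value `0` from `k` on. -/
def position (f : ℕ) : ℕ := if h : f < k then π.symm ⟨f, h⟩ else 0

theorem position_val (f : Fin k) : position π f = π.symm f := by
  simp [position]

theorem inputEdge_iff (v : Fin n) (f : Fin k) :
    InputEdge (fun i => (encodeInput I.host s π).getD i 0) n (2 + n * n) v f ↔
      f ∈ I.range s v := by
  unfold InputEdge
  beta_reduce
  rw [encodeInput_loc, encodeInput_adj]
  have hrange : f ∈ I.range s v ↔ s f = v ∨ I.host.Adj v (s f) := by
    simp only [FLG.range, Finset.mem_filter, Finset.mem_univ, true_and]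
    simp [FLG.nbhd]
  rw [hrange, or_comm, Fin.ext_iff, eq_comm]
  simp

variable {I s π}

theorem search_input_spec {R : ℕ → ℕ → Prop} {N : ℕ}
    (hm : Prepared (fun i => (encodeInput I.host s π).getD i 0) n k m) (hctx : Ctx R N k m) :
    Within search m (searchTime N k) fun m' =>
      Good R N k (position π) (m'.arr Mem.asg) (m'.arr Mem.key) k := by
  have hread : ∀ i : Fin k, m.arr Mem.io (m.var Reg.perm + i) = π i := by
    intro i
    rw [hm.arr_io, hm.perm]
    exact encodeInput_perm _ _ _ i
  refine search_spec hctx (fun f hf => ?_) (fun i hi => ?_) fun f hf => ?_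
  · rw [position, dif_pos hf]
    exact Fin.is_lt _
  · rw [hread ⟨i, hi⟩, position_val, π.symm_apply_apply]
  · refine ⟨π.symm ⟨f, hf⟩, Fin.is_lt _, ?_⟩
    rw [hread, π.apply_symm_apply]

theorem algorithm_spec (hI : I.Unweighted) :
    Within algorithm (State.init (encodeInput I.host s π)) (algorithmTime n k) fun m' =>
      ∃ a : Fin n → Option (Fin k), m'.output = encodeAssignment a ∧
        I.IsFavoring s π (assignmentProfile a) := by
  have hc : 4 * k ^ 2 ≤ 4 * k * k := le_of_eq (by ring)
  have hpos : ∀ f : Fin k, position π f < k := fun f => by rw [position_val]; exact Fin.is_lt _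
  refine Within.seq (t₂ := searchTime (4 * k * k * n) k + n * (k * (k * 30 + 14) + 14) +
    searchTime n k + n * 24 + 30) (prepare_spec (n := n) (k := k) (io := fun i => (encodeInput I.host s π).getD i 0)
    (by simp [State.init]) (by simp [encodeInput]) (by simp [encodeInput])) ?_
    (by simp only [algorithmTime]; omega)
  intro m₁ _ ⟨h₁, c₁, l₁⟩
  -- The loads of the client copies.
  refine Within.seq (t₂ := n * (k * (k * 30 + 14) + 14) + searchTime n k + n * 24 + 30)
    (search_input_spec h₁ ⟨h₁.var_k, c₁, fun _ _ => Iff.rfl⟩) ?_ (by omega)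
  intro m₂ a₂ good₂
  have h₂ := h₁.agree a₂
  have live₂ : m₂.arr Mem.live = m₁.arr Mem.live := a₂.arr _ (by decide)
  have stable₂ := isStable_toAssignment
    (E := fun (ω : Fin (4 * k * k * n)) f => f ∈ I.range s ω.modNat) good₂ (by
      intro ω f
      have hω : ω.modNat.val = ω % n := rfl
      rw [h₁.base ω (Or.inl ω.2), ← hω, l₁ _ ω.modNat.2 f f.2, inputEdge_iff])
  have class₂ := hI.classEdge_iff card_filter_modNat hc hpos stable₂
  -- Restriction to the edges within the classes.
  refine Within.seq (t₂ := searchTime n k + n * 24 + 20) (cut_spec h₂.var_n h₂.var_k fun u hu => by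
    rw [h₂.base u (Or.inr hu), Nat.mod_eq_of_lt hu]) ?_ (by omega)
  intro m₃ a₃ live₃
  have h₃ := h₂.agree a₃
  refine Within.seq (t₁ := 2) (t₂ := searchTime n k + n * 24 + 10)
    (Q := fun m' => m' = m₃.setVar Reg.cnt n)
    (Within.exec (by simp [Prog.exec, Expr.eval, h₃.var_n])) ?_ (by omega)
  rintro m₄ a₄ rfl
  have h₄ := h₃.agree a₄
  refine Within.seq (t₂ := n * 24 + 8)
    (search_input_spec (N := n) h₄ ⟨h₄.var_k, by simp, fun _ _ => Iff.rfl⟩) ?_ (by omega)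
  intro m₅ a₅ good₅
  have h₅ := h₄.agree a₅
  have stable₅ := isStable_toAssignment (E := I.ClassEdge s) good₅ (by
    intro v f
    have hbase : m₃.arr Mem.base v = v * k := by
      rw [h₃.base v (Or.inr v.2), Nat.mod_eq_of_lt v.2]
    rw [class₂, State.arr_setVar, hbase, live₃ v v.2 f f.2, live₂, l₁ v v.2 f f.2, inputEdge_iff,
      good₂.keys f f.2]
    refine and_congr_right fun _ => ⟨fun h x hx hE => ?_, fun h g hg => ?_⟩
    · rw [h₂.edge v v.2 x hx, inputEdge_iff (f := ⟨x, hx⟩)] at hE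
      have := h ⟨x, hx⟩ hE
      rwa [loadOf_toAssignment, loadOf_toAssignment, ← good₂.keys x hx] at this
    · have := h g g.2 ((h₂.edge v v.2 g g.2).2 ((inputEdge_iff _ _ _ _ _).2 hg))
      rwa [good₂.keys g g.2, ← loadOf_toAssignment, ← loadOf_toAssignment] at this)
  simp only [position_val] at stable₅
  refine (output_spec h₅.var_n h₅.var_k).mono le_rfl ?_
  intro m₆ _ ⟨len₆, io₆⟩
  refine ⟨_, ?_, hI.isFavoring stable₅⟩
  unfold State.output encodeAssignment
  rw [len₆]
  refine List.ext_getElem (by simp) fun v hv hv' => ?_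
  have hvn : v < n := by simpa using hv
  simp only [List.getElem_map, List.getElem_range, List.getElem_ofFn]
  rw [io₆ v hvn]
  unfold toAssignment
  split_ifs <;> simp

end Run

end Favoring

theorem mainTheorem7 :
    ∃ (P : RAM.Prog) (p : Polynomial ℕ),
      ∀ (n k : ℕ) (I : FLG n k), I.Unweighted →
        ∀ (s : Fin k → Fin n), I.IsFPP s → ∀ (π : Equiv.Perm (Fin k)),
          ∃ (t : ℕ) (a : Fin n → Option (Fin k)),
            P.Outputs (encodeInput I.host s π) (encodeAssignment a) t ∧
            t ≤ p.eval (encodeInput I.host s π).length ∧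
            I.IsFavoring s π (assignmentProfile a) := by
  refine ⟨Favoring.algorithm, Favoring.algorithmTime Polynomial.X Polynomial.X, ?_⟩
  intro n k I hI s _ π
  obtain ⟨t, m, hr, ht, a, ha, hfav⟩ := Favoring.algorithm_spec (s := s) (π := π) hI
  refine ⟨t, a, ⟨m, hr, ha⟩, ht.trans ?_, hfav⟩
  set Z := (encodeInput I.host s π).length with hZ
  rw [Favoring.length_encodeInput] at hZ
  -- All time bounds are monotone, so `n` and `k` may be replaced by the length of the input.
  have hn : n ≤ Z := by nlinarith
  have hk : k ≤ Z := by nlinarith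
  have heval : (Favoring.algorithmTime (Polynomial.X : Polynomial ℕ) Polynomial.X).eval Z =
      Favoring.algorithmTime Z Z := by
    simp [Favoring.algorithmTime, Favoring.prepareTime, Search.searchTime]
  rw [heval]
  simp only [Favoring.algorithmTime, Favoring.prepareTime, Search.searchTime]
  gcongr
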